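/- **Setting.** For a natural number $u$ let $U=[u]=\{0,\dots,u-1\}$, and let $R=[2^\rho]$, viewed as the set of bit strings of length $\rho$; $\oplus$ is bit-wise exclusive-or. Let $\Phi=[2^b]$ be an alphabet of $b$-bit characters. If $u\le |\Phi|^{n}$, a key $x\in U$ is viewed as the vector $(x_0,\dots,x_{n-1})\in\Phi^{n}$ of its $n$ base-$2^b$ digits. A *simple tabulation* function with character tables $t_0,\dots,t_{n-1}$ maps $(x_0,\dots,x_{n-1})$ to $t_0(x_0)\oplus\dots\oplus t_{n-1}(x_{n-1})$. *Double tabulation* is the composition $r\circ h:U\to R$ of two simple tabulation functions, $h:\Phi^{n}\to\Phi^{d}$ (with tables $\Phi\to\Phi^d$) and $r:\Phi^{d}\to R$ (with tables $\Phi\to R$). The function $h$ is *$k$-unique* on $U$ if every non-empty $X\subseteq U$ with $|X|\le k$ contains a key $x$ for which there is a position $j$ with $h(y)_j\ne h(x)_j$ for all $y\in X\setminus\{x\}$. A family of hash functions $U\to R$ with a uniformly random seed is *$k$-independent* if the hash values of any at most $k$ distinct keys are independent random variables and every single hash value is uniform in $R$. The *universal probability* of an event is its probability over uniformly random tables of $h$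 alone, which are then fixed once and for all. **Statement.** There are absolute constants $A\in\mathbb N$, $\delta>0$ and a fixed word RAM program $P$ such that the following holds. Let $u\to\infty$ and let $c\ge 1$ be natural numbers (varying with $u$) with $c^{\,c^2}=u^{o(1)}$. Then there are natural numbers $n,d,b,k,S$ (depending on $u$ and $c$) with, for all sufficiently large $u$, $u\le 2^{bn}$ and $k\ge u^{\delta/c^2}$ (so $k=u^{\Omega(1/c^2)}$), and with $S=o(u^{1/c})$, such that: 1. With universal probability $1-o(1/u^{1/c})$, the random $h:\Phi^{n}\to\Phi^{d}$ is $k$-unique on $U$ and, with this $h$ fixed, for every $\rho$, double tabulation $r\circ h$ with uniformly random tables of $r$ is a $k$-independent hash family from $U$ to $R=[2^\rho]$. 2. For all sufficiently large $u$, for every word length $w$ such that keys and hash values fit in one word ($u\le 2^w$ and $\rho\le w$), and for all tables of $h$ and $r$, there is a representation of $r\circ h$ in a memory of $S$ words of $w$ bits from which $P$ computes $r(h(x))$, for every key $x\in U$, in at most $A\,c$ steps, using no memory beyond these $S$ words and its fixed number of registers. Here a word RAM step is one elementary operation on words (loading a constant, copying, addition, subtraction, multiplication, division, remainder, bit-wise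 and/or/xor, shifts, a comparison, or one read from or write to memory). -/

import Mathlib

open Filter Asymptotics Topology

namespace DoubleTab

/-! ### Simple and double tabulation

A character of `b` bits is a `BitVec b`; the alphabet `Φ` is `BitVec b`, so `|Φ| = 2 ^ b`.
The range `R = [2 ^ ρ]` is `BitVec ρ`, and `^^^` is bit-wise exclusive-or. -/

/-- The exclusive-or of `f 0, …, f (n - 1)`. -/
def xorSum {n m : ℕ} (f : Fin n → BitVec m) : BitVec m :=
  (List.ofFn f).foldr (fun a s => a ^^^ s) 0

/-- Simple tabulation with character tables `t 0, …, t (n - 1)`. -/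
def simpleTab {n b m : ℕ} (t : Fin n → BitVec b → BitVec m) (x : Fin n → BitVec b) : BitVec m :=
  xorSum fun i => t i (x i)

/-- Simple tabulation whose hash values are vectors of `d` characters (xor acts on each of them). -/
def simpleTabVec {n b d m : ℕ} (h : Fin n → BitVec b → Fin d → BitVec m) (x : Fin n → BitVec b) :
    Fin d → BitVec m :=
  fun j => simpleTab (fun i a => h i a j) x

/-- The key `x`, viewed as a vector of `n` characters of `b` bits
(`BitVec.ofNat b` reduces modulo `2 ^ b`; distinct keys below `2 ^ (b * n)` get distinct vectors). -/
def chars (b n x : ℕ) : Fin n → BitVec b :=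
  fun i => BitVec.ofNat b (x / 2 ^ (b * (i : ℕ)))

/-- The tables of the first simple tabulation function `h : Φ ^ n → Φ ^ d`, `Φ = BitVec b`. -/
abbrev FirstTables (b n d : ℕ) : Type := Fin n → BitVec b → Fin d → BitVec b

/-- The tables of the second simple tabulation function `r : Φ ^ d → R`, `R = BitVec ρ`. -/
abbrev SecondTables (b d ρ : ℕ) : Type := Fin d → BitVec b → BitVec ρ

/-- The first simple tabulation function as a function on the universe `U = [u]`. -/
def firstTab {b n d : ℕ} (u : ℕ) (h : FirstTables b n d) (x : Fin u) : Fin d → BitVec b :=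
  simpleTabVec h (chars b n x)

/-- Double tabulation `r ∘ h : U → R`. -/
def doubleTab {b n d ρ : ℕ} (u : ℕ) (h : FirstTables b n d) (r : SecondTables b d ρ) (x : Fin u) :
    BitVec ρ :=
  simpleTab r (firstTab u h x)

/-! ### Uniqueness and independence -/

/-- The uniform probability of an event in a finite probability space. -/
noncomputable def unifProb {Ω : Type} (E : Set Ω) : ℝ :=
  letI : MeasurableSpace Ω := ⊤
  (ProbabilityTheory.uniformOn (Set.univ : Set Ω)).real E

/-- `f` is `k`-unique: every non-empty key set `X` of at most `k` keys has a unique output position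
character `(j, f x j)`. -/
def IsKUnique {U Ψ : Type} {d : ℕ} (k : ℕ) (f : U → Fin d → Ψ) : Prop :=
  ∀ X : Finset U, X.Nonempty → X.card ≤ k →
    ∃ x ∈ X, ∃ j : Fin d, ∀ y ∈ X, y ≠ x → f y j ≠ f x j

/-- The family `(H ω)`, with `ω` uniform in the finite seed set `Ω`, is `k`-independent: the hash
values of any at most `k` distinct keys are independent random variables, and each hash value is
uniformly distributed in `R`. -/
def IsKIndependent {Ω U R : Type} (k : ℕ) (H : Ω → U → R) : Prop :=
  letI : MeasurableSpace Ω := ⊤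
  letI : MeasurableSpace R := ⊤
  (∀ X : Finset U, X.card ≤ k →
    ProbabilityTheory.iIndepFun (fun (x : X) (ω : Ω) => H ω x)
      (ProbabilityTheory.uniformOn Set.univ)) ∧
  ∀ x : U, (ProbabilityTheory.uniformOn (Set.univ : Set Ω)).map (fun ω => H ω x) =
    ProbabilityTheory.uniformOn (Set.univ : Set R)

/-- The first tables `h` are good for independence `k`: `h` is `k`-unique on `U`, and with this
fixed `h`, for every range `R = [2 ^ ρ]`, double tabulation with uniformly random second tables is
a `k`-independent hash family from `U` to `R`. -/
def IsUniversal {b n d : ℕ} (u k : ℕ) (h : FirstTables b n d) : Prop :=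
  IsKUnique k (firstTab u h) ∧
  ∀ ρ : ℕ, IsKIndependent k fun r : SecondTables b d ρ => doubleTab u h r

/-! ### The word RAM

Words have `w` bits. The machine has word registers, addressed by literals of the program (so that
a fixed program uses a fixed number of them), and a random access memory of `S` words. -/

structure State (w S : ℕ) where
  reg : ℕ → BitVec w
  mem : Fin S → BitVec w

/-- Unsigned word operations of a standard programming language. -/
inductive BinOp
  | add | sub | mul | div | mod | and | or | xor | shl | shr

def BinOp.eval {w : ℕ} : BinOp → BitVec w → BitVec w → BitVec w
  | .add, x, y => x + y
  | .sub, x, y => x - y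
  | .mul, x, y => x * y
  | .div, x, y => x / y
  | .mod, x, y => x % y
  | .and, x, y => x &&& y
  | .or, x, y => x ||| y
  | .xor, x, y => x ^^^ y
  | .shl, x, y => x <<< y.toNat
  | .shr, x, y => x >>> y.toNat

/-- Programs. Natural numbers name registers, except for the literal `v` in `const`. -/
inductive Cmd
  | skip
  | const (dst v : ℕ)
  | move (dst src : ℕ)
  | op (o : BinOp) (dst a b : ℕ)
  | load (dst addr : ℕ)
  | store (addr src : ℕ)
  | seq (P Q : Cmd)
  | branch (a b : ℕ) (P Q : Cmd)
  | loop (a b : ℕ) (P : Cmd)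

def State.setReg {w S : ℕ} (s : State w S) (i : ℕ) (v : BitVec w) : State w S :=
  { s with reg := Function.update s.reg i v }

def State.setMem {w S : ℕ} (s : State w S) (i : Fin S) (v : BitVec w) : State w S :=
  { s with mem := Function.update s.mem i v }

/-- `Exec P s t s'`: started in `s`, the program `P` halts in `s'` after `t` steps. Every elementary
instruction and every evaluated test `reg a < reg b` takes one step. An access to an address
outside the `S` memory words has no successor. -/
inductive Exec {w S : ℕ} : Cmd → State w S → ℕ → State w S → Prop
  | skip (s : State w S) : Exec .skip s 1 s
  | const (s : State w S) (dst v : ℕ) :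
      Exec (.const dst v) s 1 (s.setReg dst (BitVec.ofNat w v))
  | move (s : State w S) (dst src : ℕ) : Exec (.move dst src) s 1 (s.setReg dst (s.reg src))
  | op (s : State w S) (o : BinOp) (dst a b : ℕ) :
      Exec (.op o dst a b) s 1 (s.setReg dst (o.eval (s.reg a) (s.reg b)))
  | load (s : State w S) (dst addr : ℕ) (hS : (s.reg addr).toNat < S) :
      Exec (.load dst addr) s 1 (s.setReg dst (s.mem ⟨(s.reg addr).toNat, hS⟩))
  | store (s : State w S) (addr src : ℕ) (hS : (s.reg addr).toNat < S) :
      Exec (.store addr src) s 1 (s.setMem ⟨(s.reg addr).toNat, hS⟩ (s.reg src))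
  | seq {P Q : Cmd} {s s' s'' : State w S} {t t' : ℕ} :
      Exec P s t s' → Exec Q s' t' s'' → Exec (.seq P Q) s (t + t') s''
  | branch_true {a b : ℕ} {P Q : Cmd} {s s' : State w S} {t : ℕ} :
      (s.reg a).toNat < (s.reg b).toNat → Exec P s t s' → Exec (.branch a b P Q) s (t + 1) s'
  | branch_false {a b : ℕ} {P Q : Cmd} {s s' : State w S} {t : ℕ} :
      ¬ (s.reg a).toNat < (s.reg b).toNat → Exec Q s t s' → Exec (.branch a b P Q) s (t + 1) s'
  | loop_true {a b : ℕ} {P : Cmd} {s s' s'' : State w S} {t t' : ℕ} :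
      (s.reg a).toNat < (s.reg b).toNat → Exec P s t s' → Exec (.loop a b P) s' t' s'' →
      Exec (.loop a b P) s (t + t' + 1) s''
  | loop_false {a b : ℕ} {P : Cmd} {s : State w S} :
      ¬ (s.reg a).toNat < (s.reg b).toNat → Exec (.loop a b P) s 1 s

/-- A query: the memory holds `M`, the key `x` is in register `0`, all other registers are `0`. -/
def queryState {w S : ℕ} (M : Fin S → BitVec w) (x : ℕ) : State w S where
  reg := fun i => if i = 0 then BitVec.ofNat w x else 0
  mem := M

/-- With words of `w` bits, the program `P` evaluates the hash function `f : [u] → [2 ^ ρ]` in at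
most `T` steps per key, from a representation of `f` and with a memory of `S` words in total. The
hash value is left in register `0`. -/
def Evaluates {u ρ : ℕ} (P : Cmd) (w S T : ℕ) (f : Fin u → BitVec ρ) : Prop :=
  ∃ M : Fin S → BitVec w, ∀ x : Fin u, ∃ (t : ℕ) (s : State w S),
    t ≤ T ∧ Exec P (queryState M x) t s ∧ s.reg 0 = (f x).setWidth w

/-! ### Asymptotics -/

/-- `f = u ^ o(1)` along the filter `l`. -/
def IsPowLittleOOne {ι : Type} (l : Filter ι) (f u : ι → ℝ) : Prop :=
  ∃ e : ι → ℝ, Tendsto e l (𝓝 0) ∧ ∀ᶠ i in l, f i = u i ^ e i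

end DoubleTab

/-!
Over `ZMod 2`, the hash values of `r ∘ h` on a key set `X` are linear in the tables of `r`. If `h`
is `k`-unique and `X` has at most `k` keys, then removing keys with a unique position character one
at a time solves this system of equations for every right-hand side, so that the values on `X` are
independent and uniform.

Conversely, let `X` have at most `k` keys and suppose that in each component `j` of `h` every key of
`X` collides with another one. Order the input characters by decreasing frequency in `X`. Each
collision is a linear relation between at most `2n` entries in the `j`-th columns of the tables of
`h`; its leading character is the last, hence rarest, one. The leading characters of component `j`
meet at least half of the keys, so for `d ≥ 32n` averaging over the superlevel sets of the frequency
gives an initial segment of `p ≤ nk` characters and `16p` relations among them with distinct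
(leading character, component) pairs. By peeling, such relations are independent, each of
probability `1 / |Φ|`, and a union bound over the characters and the relations gives failure
probability at most `|Φ| ^ (-5)`.

With `n = 2c` and `|Φ|` about `u ^ (1 / (2c))`, the `d = 64c` intermediate characters fill `64`
words of `c` packed characters. A word costs `2c` look-ups in packed first tables and `c` look-ups
in second tables, so that a query takes `O(c)` steps.
-/

namespace DoubleTab

/-! ### Bit strings as vectors over `ZMod 2` -/

theorem card_bitVec (m : ℕ) : Fintype.card (BitVec m) = 2 ^ m := by
  rw [Fintype.card_congr BitVec.equivFin.toEquiv, Fintype.card_fin]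

/-- Bit strings of length `m` as vectors over `ZMod 2`, so that exclusive-or becomes addition. -/
noncomputable def toF2 {m : ℕ} : BitVec m ≃ (Fin m → ZMod 2) :=
  Equiv.ofBijective (fun x i => if x[i] then 1 else 0) <| by
    rw [Fintype.bijective_iff_injective_and_card]
    refine ⟨fun x y h => BitVec.eq_of_getElem_eq fun i hi => ?_, by simp [card_bitVec]⟩
    have hxy := congrFun h ⟨i, hi⟩
    cases hx : x[i] <;> cases hy : y[i] <;> simp_all

theorem toF2_apply {m : ℕ} (x : BitVec m) (i : Fin m) : toF2 x i = if x[i] then 1 else 0 := rfl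

theorem toF2_xor {m : ℕ} (x y : BitVec m) : toF2 (x ^^^ y) = toF2 x + toF2 y := by
  ext i
  cases hx : x[i] <;> cases hy : y[i] <;>
    simp_all [toF2_apply, CharTwo.add_self_eq_zero]

theorem xorSum_succ {n m : ℕ} (f : Fin (n + 1) → BitVec m) :
    xorSum f = f 0 ^^^ xorSum fun i : Fin n => f i.succ := by
  simp [xorSum, List.ofFn_succ]

theorem toF2_xorSum {n m : ℕ} (f : Fin n → BitVec m) : toF2 (xorSum f) = ∑ i, toF2 (f i) := by
  induction n with
  | zero =>
    ext i
    simp [xorSum, toF2_apply]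
  | succ n ih => rw [Fin.sum_univ_succ, xorSum_succ, toF2_xor, ih]

theorem sum_symmDiff {α G : Type*} [DecidableEq α] [AddCommGroup G] [Module (ZMod 2) G]
    (s t : Finset α) (f : α → G) :
    ∑ a ∈ symmDiff s t, f a = ∑ a ∈ s, f a + ∑ a ∈ t, f a := by
  have hst : Disjoint (s \ t) (t \ s) := disjoint_sdiff_sdiff
  rw [symmDiff_def, Finset.sup_eq_union, Finset.sum_union hst,
    ← Finset.sum_inter_add_sum_sdiff s t f, ← Finset.sum_inter_add_sum_sdiff t s f,
    Finset.inter_comm t s, add_add_add_comm, ZModModule.add_self, zero_add]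

/-! ### Position characters -/

/-- The position characters `(i, x i)` of a vector `x` of characters. Simple tabulation adds up one
table entry for each of them. -/
def posChars {n : ℕ} {Φ : Type*} (x : Fin n → Φ) : Finset (Fin n × Φ) :=
  Finset.univ.map ⟨fun i => (i, x i), fun _ _ h => congrArg Prod.fst h⟩

section posChars

variable {n : ℕ} {Φ : Type*} {x : Fin n → Φ}

theorem mem_posChars {a : Fin n × Φ} : a ∈ posChars x ↔ x a.1 = a.2 := by
  simp only [posChars, Finset.mem_map, Finset.mem_univ, true_and]
  exact ⟨fun ⟨_, hi⟩ => hi ▸ rfl, fun h => ⟨a.1, Prod.ext rfl h⟩⟩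

theorem card_posChars : (posChars x).card = n := by
  simp [posChars]

theorem posChars_injective : Function.Injective (posChars : (Fin n → Φ) → Finset (Fin n × Φ)) := by
  intro x y h
  ext i
  have hi : (i, x i) ∈ posChars y := h ▸ mem_posChars.2 rfl
  exact (mem_posChars.1 hi).symm

end posChars

theorem toF2_simpleTab {n b m : ℕ} (t : Fin n → BitVec b → BitVec m) (x : Fin n → BitVec b) :
    toF2 (simpleTab t x) = ∑ a ∈ posChars x, toF2 (t a.1 a.2) := by
  rw [simpleTab, toF2_xorSum, posChars, Finset.sum_map]
  rfl

theorem chars_injOn (b n : ℕ) : Set.InjOn (chars b n) (Set.Iio (2 ^ (b * n))) := by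
  intro x hx y hy h
  have mod_eq (m : ℕ) (hm : m ≤ n) : x % (2 ^ b) ^ m = y % (2 ^ b) ^ m := by
    induction m with
    | zero => simp [Nat.mod_one]
    | succ m ih =>
      have hc := congrArg BitVec.toNat (congrFun h ⟨m, hm⟩)
      simp only [chars, BitVec.toNat_ofNat, pow_mul] at hc
      rw [Nat.mod_pow_succ, Nat.mod_pow_succ, ih (by omega), hc]
  simpa [← pow_mul, Nat.mod_eq_of_lt hx, Nat.mod_eq_of_lt hy] using mod_eq n le_rfl

/-! ### Peelable systems of equations -/

/-- A family of finite sets of variables is peelable if in every non-empty finite part of the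
family some set has a variable of its own. The linear system with these supports can then be solved
by eliminating one equation at a time. -/
def Peelable {T V : Type*} (D : T → Finset V) : Prop :=
  ∀ Y : Finset T, Y.Nonempty → ∃ t ∈ Y, ∃ v ∈ D t, ∀ s ∈ Y, s ≠ t → v ∉ D s

theorem Peelable.exists_solution {T V G : Type*} [AddCommGroup G] {D : T → Finset V}
    (hD : Peelable D) (X : Finset T) (y : T → G) :
    ∃ a : V → G, ∀ t ∈ X, ∑ v ∈ D t, a v = y t := by
  classical
  induction X using Finset.strongInduction with
  | H X ih =>
    rcases X.eq_empty_or_nonempty with rfl | hX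
    · exact ⟨0, by simp⟩
    obtain ⟨t, ht, v, hv, hv_unique⟩ := hD X hX
    obtain ⟨a, ha⟩ := ih (X.erase t) (Finset.erase_ssubset ht)
    refine ⟨Function.update a v (y t - ∑ v' ∈ D t \ {v}, a v'), fun s hs => ?_⟩
    by_cases hst : s = t
    · subst hst
      rw [Finset.sum_update_of_mem hv, sub_add_cancel]
    · rw [Finset.sum_update_of_notMem (hv_unique s hs hst)]
      exact ha s (Finset.mem_erase.2 ⟨hst, hs⟩)

/-! ### Uniform probabilities -/

open MeasureTheory ProbabilityTheory

theorem unifProb_eq_card_div_card {Ω : Type} [Finite Ω] (E : Set Ω) :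
    unifProb E = Nat.card E / Nat.card Ω := by
  let _ : MeasurableSpace Ω := ⊤
  have := Fintype.ofFinite Ω
  rw [unifProb, measureReal_def, uniformOn_univ,
    Measure.count_apply MeasurableSpace.measurableSet_top, ← E.toFinite.cast_ncard_eq]
  simp [← Nat.card_coe_set_eq]

theorem unifProb_nonneg {Ω : Type} (E : Set Ω) : 0 ≤ unifProb E :=
  measureReal_nonneg

theorem unifProb_mono {Ω : Type} [Finite Ω] {E F : Set Ω} (h : E ⊆ F) :
    unifProb E ≤ unifProb F := by
  rw [unifProb_eq_card_div_card, unifProb_eq_card_div_card]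
  gcongr
  exact Nat.card_mono F.toFinite h

theorem unifProb_preimage_equiv {Ω Ω' : Type} [Finite Ω] [Finite Ω'] (e : Ω ≃ Ω') (E : Set Ω') :
    unifProb (e ⁻¹' E) = unifProb E := by
  rw [unifProb_eq_card_div_card, unifProb_eq_card_div_card, Nat.card_congr e,
    Nat.card_preimage_of_injective e.injective (by simp)]

theorem card_fiber_mul_card_of_surjective {A B : Type*} [AddGroup A] [AddGroup B] [Finite A]
    [Finite B] {F : A →+ B} (hF : Function.Surjective F) (b : B) :
    Nat.card {a // F a = b} * Nat.card B = Nat.card A := by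
  have hfiber (b' : B) : Nat.card {a // F a = b'} = Nat.card {a // F a = b} := by
    have := Fintype.ofFinite A
    classical
    simpa [Fintype.card_subtype] using AddMonoidHom.card_fiber_eq_of_mem_range F (hF b') (hF b)
  have := Fintype.ofFinite B
  rw [← Nat.card_congr (Equiv.sigmaFiberEquiv F), Nat.card_sigma]
  simp [hfiber, mul_comm]

theorem Peelable.unifProb_eq {T V G : Type} [Finite T] [Finite V] [AddCommGroup G] [Finite G]
    {D : T → Finset V} (hD : Peelable D) (y : T → G) :
    unifProb {a : V → G | ∀ t, ∑ v ∈ D t, a v = y t} = ((Nat.card G : ℝ) ^ Nat.card T)⁻¹ := by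
  let F : (V → G) →+ (T → G) :=
    { toFun := fun a t => ∑ v ∈ D t, a v
      map_zero' := by ext; simp
      map_add' := fun a a' => by ext; simp [Finset.sum_add_distrib] }
  have hF : Function.Surjective F := fun z => by
    have := Fintype.ofFinite T
    obtain ⟨a, ha⟩ := hD.exists_solution Finset.univ z
    exact ⟨a, funext fun t => ha t (Finset.mem_univ t)⟩
  have hfiber := card_fiber_mul_card_of_surjective hF y
  have hset : {a : V → G | ∀ t, ∑ v ∈ D t, a v = y t} = {a | F a = y} :=
    Set.ext fun a => funext_iff.symm
  have hpos : (Nat.card {a // F a = y} : ℝ) ≠ 0 := by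
    have : Nonempty {a // F a = y} := let ⟨a, ha⟩ := hF y; ⟨a, ha⟩
    exact_mod_cast Nat.card_pos.ne'
  rw [hset, unifProb_eq_card_div_card, ← hfiber, Nat.cast_mul, Nat.card_fun, Nat.cast_pow]
  exact div_mul_cancel_left₀ hpos _

theorem isKIndependent_of_unifProb_eq {Ω U R : Type} [Finite Ω] [Nonempty Ω] [Finite R] {k : ℕ}
    (hk : 1 ≤ k) {H : Ω → U → R}
    (h : ∀ X : Finset U, X.card ≤ k → ∀ y : X → R,
      unifProb {ω | ∀ x : X, H ω x = y x} = ((Nat.card R : ℝ) ^ X.card)⁻¹) :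
    IsKIndependent k H := by
  let _ : MeasurableSpace Ω := ⊤
  let _ : MeasurableSpace R := ⊤
  have := Fintype.ofFinite R
  have (x : U) : IsProbabilityMeasure ((uniformOn (Set.univ : Set Ω)).map fun ω => H ω x) :=
    Measure.isProbabilityMeasure_map measurable_from_top.aemeasurable
  have hmarginal (x : U) (y : R) :
      ((uniformOn Set.univ).map fun ω => H ω x).real {y} = (Nat.card R : ℝ)⁻¹ := by
    have hx : unifProb {ω | H ω x = y} = (Nat.card R : ℝ)⁻¹ := by
      simpa using h {x} (by simpa using hk) fun _ => y
    rw [map_measureReal_apply measurable_from_top (measurableSet_singleton y)]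
    exact hx
  refine ⟨fun X hX => ?_, fun x => ?_⟩
  · rw [iIndepFun_iff_map_fun_eq_pi_map fun _ => measurable_from_top.aemeasurable]
    refine Measure.ext_of_measureReal_singleton fun y => ?_
    have hjoint : (fun ω (x : X) => H ω x) ⁻¹' {y} = {ω | ∀ x : X, H ω x = y x} :=
      Set.ext fun ω => funext_iff
    rw [map_measureReal_apply measurable_from_top (measurableSet_singleton y), hjoint,
      measureReal_def _ {y}, Measure.pi_singleton, ENNReal.toReal_prod]
    simp only [← measureReal_def, hmarginal, Finset.prod_const, Finset.card_univ,
      Fintype.card_coe, inv_pow]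
    exact h X hX y
  · have : Nonempty R := ⟨H (Classical.arbitrary Ω) x⟩
    refine Measure.ext_of_measureReal_singleton fun y => ?_
    have hy : unifProb {y} = (Nat.card R : ℝ)⁻¹ := by simp [unifProb_eq_card_div_card]
    exact (hmarginal x y).trans hy.symm

/-! ### Uniqueness gives independence -/

theorem IsKUnique.peelable {U Ψ : Type} {d k : ℕ} {f : U → Fin d → Ψ} (hf : IsKUnique k f)
    {X : Finset U} (hX : X.card ≤ k) : Peelable fun x : X => posChars (f x) := by
  intro Y hY
  have hYk : (Y.map (Function.Embedding.subtype _)).card ≤ k := by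
    rw [Finset.card_map]
    exact Y.card_le_univ.trans (by simpa using hX)
  obtain ⟨_, hxY, j, hj⟩ := hf _ hY.map hYk
  obtain ⟨x, hx, rfl⟩ := Finset.mem_map.1 hxY
  refine ⟨x, hx, (j, f x j), mem_posChars.2 rfl, fun y hy hyx hmem => ?_⟩
  exact hj y (Finset.mem_map_of_mem _ hy) (Subtype.coe_ne_coe.2 hyx) (mem_posChars.1 hmem)

/-- Tables of bit strings, reindexed by position characters. -/
noncomputable def tablesEquiv (n b m : ℕ) :
    (Fin n → BitVec b → BitVec m) ≃ (Fin n × BitVec b → Fin m → ZMod 2) :=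
  (Equiv.curry _ _ _).symm.trans (Equiv.arrowCongr (Equiv.refl _) toF2)

theorem IsKUnique.isKIndependent_simpleTab {U : Type} {b d k : ℕ} (hk : 1 ≤ k)
    {f : U → Fin d → BitVec b} (hf : IsKUnique k f) (ρ : ℕ) :
    IsKIndependent k fun (r : SecondTables b d ρ) x => simpleTab r (f x) := by
  refine isKIndependent_of_unifProb_eq hk fun X hX y => ?_
  have hsystem : {r : SecondTables b d ρ | ∀ x : X, simpleTab r (f x) = y x} =
      tablesEquiv d b ρ ⁻¹' {a | ∀ x : X, ∑ v ∈ posChars (f x), a v = toF2 (y x)} := by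
    ext r
    refine forall_congr' fun x => ?_
    rw [← toF2.apply_eq_iff_eq, toF2_simpleTab]
    rfl
  rw [hsystem, unifProb_preimage_equiv, (hf.peelable hX).unifProb_eq, Nat.card_congr toF2]
  simp

/-! ### Frequent characters -/

theorem exists_superlevel_sum_nonneg {C M : Type*} [Fintype C] [AddCommGroup M] [LinearOrder M]
    [IsOrderedAddMonoid M] (w : C → ℕ) (φ : C → M) (hw : ∃ a, 0 < w a) (h : 0 ≤ ∑ a, w a • φ a) :
    ∃ s, (∃ a, s < w a) ∧ 0 ≤ ∑ a with s < w a, φ a := by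
  obtain ⟨a₀, ha₀⟩ := hw
  set N := Finset.univ.sup w with hN
  have layer_cake : ∑ a, w a • φ a = ∑ s ∈ Finset.range N, ∑ a with s < w a, φ a := by
    simp_rw [Finset.sum_filter]
    rw [Finset.sum_comm]
    refine Finset.sum_congr rfl fun a _ => ?_
    have hlayers : (Finset.range N).filter (· < w a) = Finset.range (w a) := by
      ext s
      simpa only [Finset.mem_filter, Finset.mem_range, and_iff_right_iff_imp] using
        fun hs => hs.trans_le (Finset.le_sup (Finset.mem_univ a))
    rw [← Finset.sum_filter, hlayers, Finset.sum_const, Finset.card_range]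
  have hN_pos : (Finset.range N).Nonempty :=
    Finset.nonempty_range_iff.2 (ha₀.trans_le (Finset.le_sup (Finset.mem_univ a₀))).ne'
  rw [layer_cake, ← Finset.sum_const_zero] at h
  obtain ⟨s, hs, hs_nonneg⟩ := Finset.exists_le_of_sum_le hN_pos h
  obtain ⟨a, -, ha⟩ := Finset.lt_sup_iff.1 (Finset.mem_range.1 hs)
  exact ⟨s, ⟨a, ha⟩, hs_nonneg⟩

theorem exists_linearOrder_antitone {C : Type*} [Finite C] (w : C → ℕ) :
    ∃ _ : LinearOrder C, Antitone w := by
  obtain ⟨N, ⟨e⟩⟩ := Finite.exists_equiv_fin C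
  let key (a : C) : ℕᵒᵈ ×ₗ Fin N := toLex (OrderDual.toDual (w a), e a)
  have key_injective : Function.Injective key := fun a b h =>
    e.injective (congrArg Prod.snd (toLex.injective h))
  refine ⟨LinearOrder.lift' key key_injective, fun a b hab => ?_⟩
  exact OrderDual.toDual_le_toDual.1 (Prod.Lex.monotone_fst (key a) (key b) hab)

theorem card_le_two_mul_card_of_colliding {U Ψ : Type*} (g : U → Ψ) {X Y : Finset U}
    (hcoll : ∀ x ∈ X, ∃ y ∈ X, y ≠ x ∧ g y = g x)
    (hY : ∀ x ∈ X, ∀ y ∈ X, y ≠ x → g y = g x → x ∈ Y ∨ y ∈ Y) : X.card ≤ 2 * Y.card := by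
  classical
  choose! partner hpX hp_ne hp_eq using hcoll
  have hcard : (X \ Y).card ≤ Y.card := by
    refine Finset.card_le_card_of_injOn partner (fun x hx => ?_) fun x hx y hy hxy => ?_
    · obtain ⟨hxX, hxY⟩ := Finset.mem_sdiff.1 hx
      exact (hY x hxX _ (hpX x hxX) (hp_ne x hxX) (hp_eq x hxX)).resolve_left hxY
    · obtain ⟨hxX, hxY⟩ := Finset.mem_sdiff.1 hx
      obtain ⟨hyX, hyY⟩ := Finset.mem_sdiff.1 hy
      by_contra hne
      have hg : g y = g x := by rw [← hp_eq x hxX, ← hp_eq y hyX, hxy]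
      exact (hY x hxX y hyX (Ne.symm hne) hg).elim hxY hyY
  have := Finset.card_le_card_sdiff_add_card (s := X) (t := Y)
  omega

section leading

variable {U C Ψ : Type*} {n : ℕ} (K : U → Finset C) (X : Finset U)

open Classical in
/-- The number of keys in `X` that contain the character `a`. -/
noncomputable def freq (a : C) : ℕ :=
  (X.filter fun x => a ∈ K x).card

variable {K} in
theorem sum_freq [Fintype C] (hK : ∀ x, (K x).card = n) : ∑ a, freq K X a = n * X.card := by
  classical
  have := Finset.sum_card_bipartiteAbove_eq_sum_card_bipartiteBelow
    (fun (a : C) (x : U) => a ∈ K x) (s := Finset.univ) (t := X)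
  simpa [Finset.bipartiteAbove, Finset.bipartiteBelow, hK, freq, mul_comm] using this

variable {K} in
theorem card_superlevel_freq_le [Fintype C] (hK : ∀ x, (K x).card = n) (s : ℕ) :
    (Finset.univ.filter fun a => s < freq K X a).card ≤ n * X.card := by
  rw [← sum_freq X hK, Finset.card_eq_sum_ones]
  exact (Finset.sum_le_sum fun a ha => s.zero_le.trans_lt (Finset.mem_filter.1 ha).2).trans
    (Finset.sum_le_univ_sum_of_nonneg fun _ => Nat.zero_le _)

/-- The leading characters of `g`: the largest characters in which two keys of `X` with the same
value of `g` differ. -/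
def leading [LinearOrder C] (g : U → Ψ) : Set C :=
  {a | ∃ x ∈ X, ∃ y ∈ X, g y = g x ∧ IsGreatest (symmDiff (K x) (K y) : Set C) a}

variable [Fintype C] [LinearOrder C]
variable {K X}

open Classical in
theorem card_le_two_mul_sum_freq_leading (hK : Function.Injective K) {g : U → Ψ}
    (hcoll : ∀ x ∈ X, ∃ y ∈ X, y ≠ x ∧ g y = g x) :
    X.card ≤ 2 * ∑ a with a ∈ leading K X g, freq K X a := by
  set Y := X.filter fun x => ∃ a ∈ leading K X g, a ∈ K x with hY
  have hYcard : Y.card ≤ ∑ a with a ∈ leading K X g, freq K X a := by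
    refine (Finset.card_le_card fun x hx => ?_).trans Finset.card_biUnion_le
    simpa [hY, and_comm, and_assoc] using hx
  refine (card_le_two_mul_card_of_colliding g hcoll fun x hx y hy hne hg => ?_).trans
    (Nat.mul_le_mul_left 2 hYcard)
  have hdiff : (symmDiff (K x) (K y)).Nonempty :=
    Finset.nonempty_iff_ne_empty.2 fun h => hne (hK (symmDiff_eq_bot.1 h)).symm
  have hmax := Finset.isGreatest_max' _ hdiff
  set a := (symmDiff (K x) (K y)).max' hdiff
  have ha : a ∈ leading K X g := ⟨x, hx, y, hy, hg, by simpa using hmax⟩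
  rcases Finset.mem_symmDiff.1 (Finset.mem_coe.1 hmax.1) with h | h
  · exact Or.inl (Finset.mem_filter.2 ⟨hx, a, ha, h.1⟩)
  · exact Or.inr (Finset.mem_filter.2 ⟨hy, a, ha, h.1⟩)

open Classical in
theorem mul_sum_freq_le {d : ℕ} (hKinj : Function.Injective K) (hK : ∀ x, (K x).card = n)
    {f : U → Fin d → Ψ} (hcoll : ∀ j, ∀ x ∈ X, ∃ y ∈ X, y ≠ x ∧ f y j = f x j) :
    d * ∑ a, freq K X a ≤ 2 * n * ∑ a, freq K X a *
      (Finset.univ.filter fun j => a ∈ leading K X fun x => f x j).card := by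
  set r : C → ℕ := fun a => (Finset.univ.filter fun j => a ∈ leading K X fun x => f x j).card
  have hswap : ∑ a, freq K X a * r a =
      ∑ j, ∑ a with a ∈ leading K X fun x => f x j, freq K X a := by
    simp_rw [Finset.sum_filter]
    rw [Finset.sum_comm]
    simp [r, Finset.sum_ite, mul_comm]
  have hd : d * X.card ≤ 2 * ∑ a, freq K X a * r a := by
    rw [hswap, Finset.mul_sum]
    simpa using Finset.card_nsmul_le_sum Finset.univ _ _ fun j _ =>
      card_le_two_mul_sum_freq_leading hKinj (hcoll j)
  rw [sum_freq X hK]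
  linarith [Nat.mul_le_mul_left n hd]

open Classical in
theorem exists_superlevel_dense_leading {d : ℕ} (hn : 0 < n) (hKinj : Function.Injective K)
    (hK : ∀ x, (K x).card = n) (hX : X.Nonempty) {f : U → Fin d → Ψ}
    (hcoll : ∀ j, ∀ x ∈ X, ∃ y ∈ X, y ≠ x ∧ f y j = f x j) :
    ∃ s, (∃ a, s < freq K X a) ∧ d * (Finset.univ.filter fun a => s < freq K X a).card ≤
      2 * n * ∑ a with s < freq K X a,
        (Finset.univ.filter fun j => a ∈ leading K X fun x => f x j).card := by
  set r : C → ℕ := fun a => (Finset.univ.filter fun j => a ∈ leading K X fun x => f x j).card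
  have freq_pos : ∃ a, 0 < freq K X a := by
    by_contra! h
    have := sum_freq X hK
    simp_all [hX.ne_empty, hn.ne']
  have weighted_sum_nonneg : 0 ≤ ∑ a, freq K X a • (2 * n * r a - d : ℤ) := by
    have hexpand : ∑ a, freq K X a • (2 * n * r a - d : ℤ) =
        2 * n * ∑ a, (freq K X a * r a : ℤ) - d * ∑ a, (freq K X a : ℤ) := by
      simp only [Finset.mul_sum, ← Finset.sum_sub_distrib]
      exact Finset.sum_congr rfl fun a _ => by rw [nsmul_eq_mul]; ring
    rw [hexpand, sub_nonneg]
    exact_mod_cast mul_sum_freq_le hKinj hK hcoll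
  obtain ⟨s, hs, hsum⟩ := exists_superlevel_sum_nonneg (freq K X) _ freq_pos weighted_sum_nonneg
  refine ⟨s, hs, ?_⟩
  rw [Finset.sum_sub_distrib, Finset.sum_const, nsmul_eq_mul, mul_comm _ (d : ℤ),
    ← Finset.mul_sum, sub_nonneg] at hsum
  exact_mod_cast hsum

end leading

/-! ### Relations between characters -/

section relations

variable {U C G : Type} {n d p m : ℕ} [AddCommGroup G]

/-- Simple tabulation with an arbitrary set `K x` of characters for each key `x` and vectors over an
arbitrary group as table entries. -/
def sumTab (K : U → Finset C) (h : C → Fin d → G) (x : U) (j : Fin d) : G :=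
  ∑ a ∈ K x, h a j

/-- The tables `h` satisfy a system of relations of length at most `m` between the characters
`α 0, …, α (p - 1)`: for each `(i, j)` in `T`, the `j`-th components of some of the `h (α q)` sum to
zero, where `i` is the largest such `q`. -/
def HasRelations (m : ℕ) (α : Fin p → C) (T : Finset (Fin p × Fin d)) (h : C → Fin d → G) : Prop :=
  ∃ Q : T → Finset (Fin p), ∀ t : T, IsGreatest (Q t : Set (Fin p)) t.1.1 ∧ (Q t).card ≤ m ∧
    ∑ q ∈ Q t, h (α q) t.1.2 = 0

variable [Module (ZMod 2) G]

theorem exists_relation_of_mem_leading [LinearOrder C] {K : U → Finset C}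
    (hK : ∀ x, (K x).card = n) {X : Finset U} {h : C → Fin d → G} {j : Fin d} (α : Fin p ↪o C)
    (hα : IsLowerSet (Set.range α)) {i : Fin p}
    (hi : α i ∈ leading K X fun x => sumTab K h x j) :
    ∃ Q : Finset (Fin p), IsGreatest (Q : Set (Fin p)) i ∧ Q.card ≤ 2 * n ∧
      ∑ q ∈ Q, h (α q) j = 0 := by
  obtain ⟨x, -, y, -, hxy, hmem, hmax⟩ := hi
  set Q : Finset (Fin p) := Finset.univ.filter fun q => α q ∈ symmDiff (K x) (K y) with hQ
  have hQmap : Q.map α.toEmbedding = symmDiff (K x) (K y) := by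
    ext a
    simp only [hQ, Finset.mem_map, Finset.mem_filter_univ]
    refine ⟨?_, fun ha => ?_⟩
    · rintro ⟨q, hq, rfl⟩
      exact hq
    · obtain ⟨q, rfl⟩ := hα (hmax (by simpa using Finset.mem_coe.2 ha)) ⟨i, rfl⟩
      exact ⟨q, ha, rfl⟩
  refine ⟨Q, ⟨by simpa [hQ, Finset.mem_symmDiff, Set.mem_symmDiff] using hmem, fun q hq => ?_⟩,
    ?_, ?_⟩
  · refine α.le_iff_le.1 (hmax ?_)
    simpa [hQ, Finset.mem_symmDiff, Set.mem_symmDiff] using hq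
  · calc Q.card = (symmDiff (K x) (K y)).card := by rw [← hQmap, Finset.card_map]
      _ ≤ (K x ∪ K y).card := Finset.card_le_card Finset.symmDiff_subset_union
      _ ≤ (K x).card + (K y).card := Finset.card_union_le _ _
      _ = 2 * n := by rw [hK, hK, two_mul]
  · have hsum : ∑ a ∈ symmDiff (K x) (K y), h a j = sumTab K h x j + sumTab K h y j :=
      sum_symmDiff _ _ _
    have hzero : sumTab K h x j + sumTab K h y j = 0 := by
      rw [show sumTab K h y j = sumTab K h x j from hxy, ZModModule.add_self]
    rw [hzero, ← hQmap, Finset.sum_map] at hsum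
    exact hsum

theorem exists_hasRelations [Finite C] {K : U → Finset C} (hn : 0 < n)
    (hKinj : Function.Injective K) (hK : ∀ x, (K x).card = n) {k : ℕ} {h : C → Fin d → G}
    (hk : ¬ IsKUnique k (sumTab K h)) :
    ∃ p ∈ Finset.Icc 1 (n * k), ∃ (α : Fin p → C) (T : Finset (Fin p × Fin d)),
      Function.Injective α ∧ d * p ≤ 2 * n * T.card ∧ HasRelations (2 * n) α T h := by
  classical
  unfold IsKUnique at hk
  push Not at hk
  obtain ⟨X, hX, hXk, hcoll⟩ := hk
  have := Fintype.ofFinite C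
  obtain ⟨_, hanti⟩ := exists_linearOrder_antitone (freq K X)
  obtain ⟨s, ⟨a₀, ha₀⟩, hdense⟩ :=
    exists_superlevel_dense_leading hn hKinj hK hX fun j x hx => hcoll x hx j
  set A : Finset C := Finset.univ.filter fun a => s < freq K X a with hA
  let α := A.orderEmbOfFin rfl
  let T : Finset (Fin A.card × Fin d) :=
    Finset.univ.filter fun t => α t.1 ∈ leading K X fun x => sumTab K h x t.2
  have hα : IsLowerSet (Set.range α) := by
    rintro a b hba
    simpa [α, hA] using fun ha => ha.trans_le (hanti hba)
  have hT : T.card =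
      ∑ a ∈ A, (Finset.univ.filter fun j => a ∈ leading K X fun x => sumTab K h x j).card := by
    conv_rhs => rw [← Finset.map_orderEmbOfFin_univ A rfl, Finset.sum_map]
    simp only [T, Finset.card_filter, Fintype.sum_prod_type]
    rfl
  have hAcard : A.card ≤ n * k :=
    (card_superlevel_freq_le X hK s).trans (Nat.mul_le_mul_left n hXk)
  have hApos : 1 ≤ A.card := Finset.card_pos.2 ⟨a₀, by simpa [hA] using ha₀⟩
  refine ⟨A.card, Finset.mem_Icc.2 ⟨hApos, hAcard⟩, α, T, α.injective, hT ▸ hdense, ?_⟩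
  choose Q hQ using fun t : T =>
    exists_relation_of_mem_leading hK α hα (Finset.mem_filter.1 t.2).2
  exact ⟨Q, hQ⟩

end relations

/-! ### The union bound -/

section unionBound

variable {C G : Type} {d p m : ℕ} [Finite C] [AddCommGroup G] [Finite G]

theorem unifProb_le_sum {Ω κ : Type} [Finite Ω] {E : Set Ω} (s : Finset κ) (F : κ → Set Ω)
    (hE : E ⊆ ⋃ i ∈ s, F i) : unifProb E ≤ ∑ i ∈ s, unifProb (F i) := by
  let _ : MeasurableSpace Ω := ⊤
  exact (unifProb_mono hE).trans (measureReal_biUnion_finset_le s F)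

/-- Peeling off the equations by decreasing largest index shows that they are independent. -/
theorem unifProb_forall_sum_eq_zero {α : Fin p → C} (hα : Function.Injective α)
    {T : Finset (Fin p × Fin d)} {Q : T → Finset (Fin p)}
    (hQ : ∀ t, IsGreatest (Q t : Set (Fin p)) t.1.1) :
    unifProb {h : C → Fin d → G | ∀ t : T, ∑ q ∈ Q t, h (α q) t.1.2 = 0} =
      ((Nat.card G : ℝ) ^ T.card)⁻¹ := by
  let D (t : T) : Finset (C × Fin d) :=
    (Q t).map ⟨fun q => (α q, t.1.2), fun _ _ h => hα (congrArg Prod.fst h)⟩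
  have hD : Peelable D := by
    intro Y hY
    obtain ⟨t, ht, hmax⟩ := Finset.exists_max_image Y (fun t => t.1.1) hY
    refine ⟨t, ht, (α t.1.1, t.1.2), Finset.mem_map.2 ⟨t.1.1, (hQ t).1, rfl⟩,
      fun s hs hne hmem => hne ?_⟩
    obtain ⟨q, hq, hqt⟩ := Finset.mem_map.1 hmem
    obtain ⟨hq1, hs2⟩ := Prod.mk.inj hqt
    have hts : t.1.1 ≤ s.1.1 := hα hq1 ▸ (hQ s).2 hq
    exact Subtype.ext (Prod.ext ((hmax s hs).antisymm hts) hs2)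
  have hcurry : {h : C → Fin d → G | ∀ t : T, ∑ q ∈ Q t, h (α q) t.1.2 = 0} =
      (Equiv.curry C (Fin d) G).symm ⁻¹' {a | ∀ t, ∑ v ∈ D t, a v = (0 : T → G) t} := by
    refine Set.ext fun h => forall_congr' fun t => ?_
    simp only [D, Finset.sum_map]
    rfl
  rw [hcurry, unifProb_preimage_equiv, hD.unifProb_eq]
  simp

theorem exists_image_univ_eq {α : Type*} [DecidableEq α] {Q : Finset α} (hQ : Q.Nonempty)
    (hm : Q.card ≤ m) : ∃ g : Fin m → α, Finset.univ.image g = Q := by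
  have := hQ.to_subtype
  obtain ⟨e⟩ : Nonempty (Q ↪ Fin m) := Function.Embedding.nonempty_of_card_le (by simpa)
  refine ⟨Subtype.val ∘ Function.invFun e, ?_⟩
  rw [← Finset.image_image,
    Finset.image_univ_of_surjective (Function.invFun_surjective e.injective)]
  simp

theorem unifProb_hasRelations_le {α : Fin p → C} (hα : Function.Injective α)
    (T : Finset (Fin p × Fin d)) :
    unifProb {h : C → Fin d → G | HasRelations m α T h} ≤
      ((p : ℝ) ^ m / Nat.card G) ^ T.card := by
  let E (g : T → Fin m → Fin p) : Set (C → Fin d → G) :=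
    {h | (∀ t, IsGreatest (Finset.univ.image (g t) : Set (Fin p)) t.1.1) ∧
      ∀ t : T, ∑ q ∈ Finset.univ.image (g t), h (α q) t.1.2 = 0}
  have hE (g) : unifProb (E g) ≤ ((Nat.card G : ℝ) ^ T.card)⁻¹ := by
    by_cases hg : ∀ t, IsGreatest (Finset.univ.image (g t) : Set (Fin p)) t.1.1
    · exact (unifProb_mono fun _ h => h.2).trans_eq (unifProb_forall_sum_eq_zero hα hg)
    · have hempty : E g = ∅ := Set.eq_empty_of_forall_notMem fun _ h => hg h.1
      rw [hempty, unifProb_eq_card_div_card]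
      simp
  calc _ ≤ ∑ g, unifProb (E g) := unifProb_le_sum Finset.univ E fun h hh => by
        obtain ⟨Q, hQ⟩ := hh
        choose g hg using fun t =>
          exists_image_univ_eq (Q := Q t) ⟨_, Finset.mem_coe.1 (hQ t).1.1⟩ (hQ t).2.1
        exact Set.mem_biUnion (Finset.mem_univ g)
          ⟨fun t => by rw [hg]; exact (hQ t).1, fun t => by rw [hg]; exact (hQ t).2.2⟩
    _ ≤ ∑ _g : T → Fin m → Fin p, ((Nat.card G : ℝ) ^ T.card)⁻¹ :=
        Finset.sum_le_sum fun g _ => hE g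
    _ = ((p : ℝ) ^ m / Nat.card G) ^ T.card := by
        simp [div_eq_mul_inv, mul_pow]

theorem unifProb_hasRelations_le_of_le_card {α : Fin p → C} (hα : Function.Injective α)
    {T : Finset (Fin p × Fin d)} (hT : 16 * p ≤ T.card) (hm : p ^ (2 * m) ≤ Nat.card G) :
    unifProb {h : C → Fin d → G | HasRelations m α T h} ≤ ((Nat.card G : ℝ)⁻¹ ^ 8) ^ p := by
  have hB : (1 : ℝ) ≤ Nat.card G := by exact_mod_cast Nat.card_pos (α := G)
  have hm' : ((p : ℝ) ^ m) ^ 2 ≤ Nat.card G := by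
    rw [← pow_mul, mul_comm]
    exact_mod_cast hm
  set B : ℝ := (Nat.card G : ℝ)
  set q : ℝ := (p : ℝ) ^ m / B with hq
  have hq_sq : q ^ 2 ≤ B⁻¹ := by
    rw [hq, div_pow, div_le_iff₀ (by positivity)]
    calc ((p : ℝ) ^ m) ^ 2 ≤ B := hm'
      _ = B⁻¹ * B ^ 2 := by field_simp
  have hq_le : q ≤ 1 := (sq_le_one_iff₀ (by positivity)).1 (hq_sq.trans (inv_le_one_of_one_le₀ hB))
  calc _ ≤ q ^ T.card := unifProb_hasRelations_le hα T
    _ ≤ q ^ (16 * p) := pow_le_pow_of_le_one (by positivity) hq_le hT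
    _ = ((q ^ 2) ^ 8) ^ p := by ring
    _ ≤ (B⁻¹ ^ 8) ^ p := by gcongr

theorem unifProb_exists_hasRelations_le (hp : p ≠ 0) (hm : p ^ (2 * m) ≤ Nat.card G)
    (hC : Nat.card C * 2 ^ d ≤ Nat.card G ^ 2) :
    unifProb {h : C → Fin d → G | ∃ (α : Fin p → C) (T : Finset (Fin p × Fin d)),
      Function.Injective α ∧ 16 * p ≤ T.card ∧ HasRelations m α T h} ≤
      (Nat.card G : ℝ)⁻¹ ^ 6 := by
  have := Fintype.ofFinite C
  classical
  have hB : (1 : ℝ) ≤ Nat.card G := by exact_mod_cast Nat.card_pos (α := G)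
  have hC' : (Nat.card C : ℝ) * 2 ^ d ≤ (Nat.card G : ℝ) ^ 2 := by exact_mod_cast hC
  set B : ℝ := (Nat.card G : ℝ)
  let I : Finset ((Fin p → C) × Finset (Fin p × Fin d)) :=
    Finset.univ.filter fun αT => Function.Injective αT.1 ∧ 16 * p ≤ αT.2.card
  calc _ ≤ ∑ αT ∈ I, unifProb {h : C → Fin d → G | HasRelations m αT.1 αT.2 h} :=
        unifProb_le_sum I _ fun h hh => by
          obtain ⟨α, T, hα, hT, hrel⟩ := hh
          have hmem : (α, T) ∈ I := Finset.mem_filter.2 ⟨Finset.mem_univ _, hα, hT⟩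
          exact Set.mem_biUnion hmem hrel
    _ ≤ ∑ _αT ∈ I, (B⁻¹ ^ 8) ^ p := Finset.sum_le_sum fun αT hαT =>
        have hαT := (Finset.mem_filter.1 hαT).2
        unifProb_hasRelations_le_of_le_card hαT.1 hαT.2 hm
    _ ≤ ∑ _αT : (Fin p → C) × Finset (Fin p × Fin d), (B⁻¹ ^ 8) ^ p :=
        Finset.sum_le_sum_of_subset_of_nonneg (Finset.filter_subset _ _) fun _ _ _ => by positivity
    _ = (Nat.card C * 2 ^ d * B⁻¹ ^ 8) ^ p := by
        simp [mul_pow, pow_mul, pow_right_comm]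
    _ ≤ (B ^ 2 * B⁻¹ ^ 8) ^ p := by gcongr
    _ = (B⁻¹ ^ 6) ^ p := by field_simp
    _ ≤ B⁻¹ ^ 6 :=
        pow_le_of_le_one (by positivity) (pow_le_one₀ (by positivity) (inv_le_one_of_one_le₀ hB)) hp

theorem unifProb_not_isKUnique_sumTab_le [Module (ZMod 2) G] {U : Type} {n k : ℕ}
    {K : U → Finset C} (hn : 0 < n) (hKinj : Function.Injective K) (hK : ∀ x, (K x).card = n)
    (hd : 32 * n ≤ d) (hk : (n * k) ^ (4 * n) ≤ Nat.card G)
    (hC : Nat.card C * 2 ^ d ≤ Nat.card G ^ 2) :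
    unifProb {h : C → Fin d → G | ¬ IsKUnique k (sumTab K h)} ≤ ((Nat.card G : ℝ) ^ 5)⁻¹ := by
  have hB : 0 < (Nat.card G : ℝ) := by exact_mod_cast Nat.card_pos (α := G)
  have hnk : ((n * k : ℕ) : ℝ) ≤ Nat.card G := by
    exact_mod_cast (Nat.le_self_pow (by omega) _).trans hk
  set B : ℝ := (Nat.card G : ℝ)
  let E (p : ℕ) : Set (C → Fin d → G) := {h | ∃ (α : Fin p → C) (T : Finset (Fin p × Fin d)),
    Function.Injective α ∧ 16 * p ≤ T.card ∧ HasRelations (2 * n) α T h}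
  have hE (p) (hp : p ∈ Finset.Icc 1 (n * k)) : unifProb (E p) ≤ B⁻¹ ^ 6 := by
    obtain ⟨hp1, hpk⟩ := Finset.mem_Icc.1 hp
    refine unifProb_exists_hasRelations_le (by omega) ?_ hC
    calc p ^ (2 * (2 * n)) ≤ (n * k) ^ (2 * (2 * n)) := by gcongr
      _ = (n * k) ^ (4 * n) := by ring
      _ ≤ Nat.card G := hk
  calc _ ≤ ∑ p ∈ Finset.Icc 1 (n * k), unifProb (E p) := unifProb_le_sum _ E fun h hh => by
        obtain ⟨p, hp, α, T, hα, hT, hrel⟩ := exists_hasRelations hn hKinj hK hh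
        have hpT : 2 * n * (16 * p) ≤ 2 * n * T.card := by nlinarith
        exact Set.mem_biUnion hp ⟨α, T, hα, Nat.le_of_mul_le_mul_left hpT (by omega), hrel⟩
    _ ≤ ∑ _p ∈ Finset.Icc 1 (n * k), B⁻¹ ^ 6 := Finset.sum_le_sum hE
    _ = (n * k : ℕ) * B⁻¹ ^ 6 := by simp
    _ ≤ B * B⁻¹ ^ 6 := by gcongr
    _ = (B ^ 5)⁻¹ := by field_simp

end unionBound

theorem unifProb_not_isUniversal_le {b n d u k : ℕ} (hn : 0 < n) (hu : u ≤ 2 ^ (b * n))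
    (hk1 : 1 ≤ k) (hd : 32 * n ≤ d) (hk : (n * k) ^ (4 * n) ≤ 2 ^ b) (hnd : n * 2 ^ d ≤ 2 ^ b) :
    unifProb {h : FirstTables b n d | ¬ IsUniversal u k h} ≤ ((2 ^ b : ℝ) ^ 5)⁻¹ := by
  let K (x : Fin u) : Finset (Fin n × BitVec b) := posChars (chars b n x)
  have hKinj : Function.Injective K := fun x y hxy =>
    Fin.ext (chars_injOn b n (x.2.trans_le hu) (y.2.trans_le hu) (posChars_injective hxy))
  let e : FirstTables b n d ≃ (Fin n × BitVec b → Fin d → Fin b → ZMod 2) :=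
    (Equiv.curry _ _ _).symm.trans
      (Equiv.arrowCongr (Equiv.refl _) (Equiv.arrowCongr (Equiv.refl _) toF2))
  have he : {h : FirstTables b n d | ¬ IsUniversal u k h} =
      e ⁻¹' {h | ¬ IsKUnique k (sumTab K h)} := by
    ext h
    have htab (x : Fin u) (j : Fin d) : toF2 (firstTab u h x j) = sumTab K (e h) x j :=
      toF2_simpleTab _ _
    have hunique : IsKUnique k (sumTab K (e h)) ↔ IsKUnique k (firstTab u h) := by
      simp only [IsKUnique, ← htab, toF2.injective.ne_iff]
    simp only [Set.mem_ofPred_eq, Set.mem_preimage, hunique, not_iff_not]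
    exact ⟨fun h => h.1, fun h => ⟨h, h.isKIndependent_simpleTab hk1⟩⟩
  have hG : Nat.card (Fin b → ZMod 2) = 2 ^ b := by simp
  rw [he, unifProb_preimage_equiv]
  refine (unifProb_not_isKUnique_sumTab_le hn hKinj (fun x => card_posChars) hd ?_ ?_).trans_eq ?_
  · rwa [hG]
  · calc Nat.card (Fin n × BitVec b) * 2 ^ d = n * 2 ^ d * 2 ^ b := by
          simp [card_bitVec]; ring
      _ ≤ 2 ^ b * 2 ^ b := by gcongr
      _ = Nat.card (Fin b → ZMod 2) ^ 2 := by rw [hG, sq]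
  · simp

/-! ### Packed characters -/

theorem setWidth_xorSum {n m w : ℕ} (f : Fin n → BitVec m) :
    (xorSum f).setWidth w = xorSum fun i => (f i).setWidth w := by
  induction n with
  | zero => simp [xorSum]
  | succ n ih => rw [xorSum_succ, xorSum_succ, BitVec.setWidth_xor, ih]

theorem xorSum_finProd {p q m : ℕ} (f : Fin (p * q) → BitVec m) :
    (xorSum fun g : Fin p => xorSum fun j : Fin q => f (finProdFinEquiv (g, j))) = xorSum f := by
  apply toF2.injective
  simp only [toF2_xorSum]
  rw [← Fintype.sum_prod_type' (f := fun g j => toF2 (f (finProdFinEquiv (g, j))))]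
  exact Equiv.sum_comp finProdFinEquiv fun i => toF2 (f i)

/-- The characters `v 0, …, v (c - 1)` of `b` bits, side by side in a word of `w` bits, so that one
exclusive-or of words acts on all of them. -/
def pack {b c : ℕ} (w : ℕ) (v : Fin c → BitVec b) : BitVec w :=
  BitVec.ofFnLE fun t : Fin w =>
    if h : (t : ℕ) / b < c then (v ⟨t / b, h⟩).getLsbD (t % b) else false

theorem pack_xor {b c w : ℕ} (v v' : Fin c → BitVec b) :
    pack w (fun j => v j ^^^ v' j) = pack w v ^^^ pack w v' := by
  ext t ht
  simp only [pack, BitVec.getElem_xor, BitVec.getElem_ofFnLE]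
  split <;> simp

theorem xorSum_pack {n b c w : ℕ} (v : Fin n → Fin c → BitVec b) :
    (xorSum fun i => pack w (v i)) = pack w fun j => xorSum fun i => v i j := by
  induction n with
  | zero =>
    ext t ht
    simp [xorSum, pack, BitVec.getElem_ofFnLE]
  | succ n ih =>
    simp_rw [xorSum_succ]
    rw [ih, pack_xor]

theorem chars_pack {b c w : ℕ} (hw : b * c ≤ w) (v : Fin c → BitVec b) :
    chars b c (pack w v).toNat = v := by
  ext j t ht
  have hb : 0 < b := by omega
  have hlt : b * (j : ℕ) + t < w := by
    have : b * ((j : ℕ) + 1) ≤ b * c := Nat.mul_le_mul_left b j.2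
    rw [mul_add] at this
    omega
  have hdiv : (b * (j : ℕ) + t) / b = j := by
    rw [Nat.mul_add_div hb, Nat.div_eq_of_lt ht, add_zero]
  have hmod : (b * (j : ℕ) + t) % b = t := by
    rw [Nat.mul_add_mod, Nat.mod_eq_of_lt ht]
  rw [chars, ← BitVec.getLsbD_eq_getElem, ← BitVec.getLsbD_eq_getElem, BitVec.getLsbD_ofNat,
    ← Nat.shiftRight_eq_div_pow, Nat.testBit_shiftRight, BitVec.testBit_toNat,
    BitVec.getLsbD_eq_getElem hlt]
  simp [pack, BitVec.getElem_ofFnLE, hdiv, hmod, ht]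

/-! ### The word RAM program -/

section setReg

variable {w S : ℕ} (s : State w S) (i : ℕ) (v : BitVec w)

@[simp]
theorem State.reg_setReg_self : (s.setReg i v).reg i = v := by
  simp [State.setReg]

variable {i} in
@[simp]
theorem State.reg_setReg_of_ne {j : ℕ} (h : j ≠ i) : (s.setReg i v).reg j = s.reg j := by
  simp [State.setReg, h]

@[simp]
theorem State.mem_setReg : (s.setReg i v).mem = s.mem := rfl

end setReg

/-- One table look-up with the lowest character of register `y`, added to register `a`. -/
def lookupStep (y a : ℕ) : Cmd :=
  .seq (.op .and 9 y 1) <| .seq (.op .add 9 9 7) <| .seq (.load 9 9) <| .seq (.op .xor a a 9) <|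
    .seq (.op .shr y y 2) (.op .add 7 7 3)

/-- Look-ups with the consecutive characters of register `y` in the tables between the addresses in
registers `7` and `8`, added to register `a`. -/
def lookupLoop (y a : ℕ) : Cmd := .loop 7 8 (lookupStep y a)

/-- Simple tabulation of register `y` with the tables at the address in register `7`, of total size
given by register `k`. The value is added to register `a`. -/
def lookupBlock (y a k : ℕ) : Cmd := .seq (.op .add 8 7 k) (lookupLoop y a)

/-- Computes one word of packed intermediate characters and looks all of them up. -/
def groupStep : Cmd :=
  .seq (.move 10 0) <| .seq (.const 11 0) <| .seq (lookupBlock 10 11 4) (lookupBlock 11 12 5)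

/-- Loads the first `k` memory words into the registers `1, …, k`. -/
def loadParams : ℕ → Cmd
  | 0 => .skip
  | k + 1 => .seq (loadParams k) <| .seq (.const 7 k) (.load (k + 1) 7)

/-- The program that evaluates double tabulation. Apart from the layout parameters in the registers
`1, …, 6`, it uses register `7` as table pointer, `8` for the end of the current block of tables,
`9` as scratch, `10` for the remaining key characters, `11` for the remaining intermediate
characters and `12` for the hash value. -/
def evalProgram : Cmd :=
  .seq (loadParams 6) <| .seq (.const 7 6) <| .seq (.loop 7 6 groupStep) (.move 0 12)

/-- The parameters of the memory layout, stored in the first six memory words and kept in the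
registers `1, …, 6`: character mask, character length, table size, total sizes of the `m₁` first and
of the `m₂` second tables of a group, end of the memory. -/
def layoutParam (b m₁ m₂ S : ℕ) : Fin 6 → ℕ :=
  ![2 ^ b - 1, b, 2 ^ b, m₁ * 2 ^ b, m₂ * 2 ^ b, S]

/-- The invariant of all loops: the memory contains `W`, the registers `1, …, 6` the layout
parameters and register `7` the address `q` of the current table. -/
structure AtTable {w S : ℕ} (W : ℕ → BitVec w) (b m₁ m₂ q : ℕ) (s : State w S) : Prop where
  mem : s.mem = fun i : Fin S => W i
  param (i : Fin 6) : (s.reg (i + 1)).toNat = layoutParam b m₁ m₂ S i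
  pointer : (s.reg 7).toNat = q

/-- The character tables stored in `W` from the address `q` on. -/
def tablesAt {w : ℕ} (W : ℕ → BitVec w) (b m q : ℕ) : Fin m → BitVec b → BitVec w :=
  fun i a => W (q + i * 2 ^ b + a.toNat)

theorem simpleTab_tablesAt_succ {w : ℕ} (W : ℕ → BitVec w) (b m q x : ℕ) :
    simpleTab (tablesAt W b (m + 1) q) (chars b (m + 1) x) = W (q + x % 2 ^ b) ^^^
      simpleTab (tablesAt W b m (q + 2 ^ b)) (chars b m (x / 2 ^ b)) := by
  rw [simpleTab, xorSum_succ]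
  congr 1
  · simp [tablesAt, chars]
  · refine congrArg xorSum (funext fun i => ?_)
    have hchar : chars b (m + 1) x i.succ = chars b m (x / 2 ^ b) i := by
      rw [chars, chars, Nat.div_div_eq_div_mul, ← pow_add, Fin.val_succ, mul_add_one, add_comm b]
    rw [hchar, tablesAt, tablesAt, Fin.val_succ]
    ring_nf

theorem Exec.of_steps_eq {w S t t' : ℕ} {P : Cmd} {s s' : State w S} (h : Exec P s t s')
    (ht : t = t') : Exec P s t' s' := ht ▸ h

theorem Evaluates.mono {u ρ w S T T' : ℕ} {P : Cmd} {f : Fin u → BitVec ρ}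
    (h : Evaluates P w S T f) (hT : T ≤ T') : Evaluates P w S T' f := by
  obtain ⟨M, hM⟩ := h
  refine ⟨M, fun x => ?_⟩
  obtain ⟨t, s, ht, hs⟩ := hM x
  exact ⟨t, s, ht.trans hT, hs⟩

section exec

variable {w S b m₁ m₂ q : ℕ} {W : ℕ → BitVec w} {s : State w S}

theorem AtTable.setReg (hs : AtTable W b m₁ m₂ q s) {i : ℕ} (hi : 7 < i) (v : BitVec w) :
    AtTable W b m₁ m₂ q (s.setReg i v) where
  mem := hs.mem
  param j := by rw [s.reg_setReg_of_ne v (by omega), hs.param]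
  pointer := by rw [s.reg_setReg_of_ne v (by omega), hs.pointer]

theorem AtTable.mask (hs : AtTable W b m₁ m₂ q s) : (s.reg 1).toNat = 2 ^ b - 1 := hs.param 0

theorem AtTable.charLength (hs : AtTable W b m₁ m₂ q s) : (s.reg 2).toNat = b := hs.param 1

theorem AtTable.tableSize (hs : AtTable W b m₁ m₂ q s) : (s.reg 3).toNat = 2 ^ b := hs.param 2

theorem AtTable.memEnd (hs : AtTable W b m₁ m₂ q s) : (s.reg 6).toNat = S := hs.param 5

theorem AtTable.exec_lookupStep {y a : ℕ} (hs : AtTable W b m₁ m₂ q s) (hy : 10 ≤ y) (ha : 10 ≤ a)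
    (hya : y ≠ a) (hS : S < 2 ^ w) (hq : q + 2 ^ b ≤ S) :
    ∃ s' : State w S, Exec (lookupStep y a) s 6 s' ∧ AtTable W b m₁ m₂ (q + 2 ^ b) s' ∧
      (s'.reg y).toNat = (s.reg y).toNat / 2 ^ b ∧
      s'.reg a = s.reg a ^^^ W (q + (s.reg y).toNat % 2 ^ b) ∧
      Set.EqOn s'.reg s.reg {7, 9, y, a}ᶜ := by
  have hmod : (s.reg y).toNat % 2 ^ b < 2 ^ b := Nat.mod_lt _ (by positivity)
  have haddr : ((s.reg y &&& s.reg 1) + s.reg 7).toNat = q + (s.reg y).toNat % 2 ^ b := by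
    rw [BitVec.toNat_add, BitVec.toNat_and, hs.mask, Nat.and_two_pow_sub_one_eq_mod, hs.pointer,
      Nat.mod_eq_of_lt (by omega), add_comm]
  have hword (hlt) : s.mem ⟨((s.reg y &&& s.reg 1) + s.reg 7).toNat, hlt⟩ =
      W (q + (s.reg y).toNat % 2 ^ b) := by
    rw [hs.mem]
    exact congrArg W haddr
  have hnext : (s.reg 7 + s.reg 3).toNat = q + 2 ^ b := by
    rw [BitVec.toNat_add, hs.pointer, hs.tableSize, Nat.mod_eq_of_lt (by omega)]
  have hy' : y ≠ 7 ∧ y ≠ 9 ∧ 3 ≠ y ∧ 7 ≠ y := by omega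
  have ha' : a ≠ 7 ∧ a ≠ 9 ∧ 2 ≠ a ∧ 3 ≠ a ∧ 7 ≠ a := by omega
  refine ⟨_, .seq (.op s .and 9 y 1) (.seq (.op _ .add 9 9 7) (.seq (.load _ 9 9 ?_)
    (.seq (.op _ .xor a a 9) (.seq (.op _ .shr y y 2) (.op _ .add 7 7 3))))), ⟨?_, ?_, ?_⟩,
    ?_, ?_, ?_⟩
  · simp only [State.reg_setReg_self, BinOp.eval, State.reg_setReg_of_ne _ _ (show 7 ≠ 9 by decide),
      haddr]
    omega
  · simp [hs.mem]
  · intro i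
    have hi : i.val + 1 ≠ 7 ∧ i.val + 1 ≠ 9 ∧ i.val + 1 ≠ y ∧ i.val + 1 ≠ a := by omega
    simp [hi, hs.param]
  · simp [BinOp.eval, hy', ha', hnext, -BitVec.toNat_add]
  · simp [BinOp.eval, hy', ha', hya, hs.charLength, Nat.shiftRight_eq_div_pow]
  · simp [BinOp.eval, hy', ha', hya.symm, hword, -BitVec.toNat_add]
  · intro i hi
    simp only [Set.mem_compl_iff, Set.mem_insert_iff, Set.mem_singleton_iff, not_or] at hi
    simp [hi]

theorem AtTable.exec_lookupLoop {y a : ℕ} (hy : 10 ≤ y) (ha : 10 ≤ a) (hya : y ≠ a)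
    (hS : S < 2 ^ w) {m : ℕ} (hs : AtTable W b m₁ m₂ q s)
    (hend : (s.reg 8).toNat = q + m * 2 ^ b) (hq : q + m * 2 ^ b ≤ S) :
    ∃ s' : State w S, Exec (lookupLoop y a) s (7 * m + 1) s' ∧
      AtTable W b m₁ m₂ (q + m * 2 ^ b) s' ∧
      s'.reg a = s.reg a ^^^ simpleTab (tablesAt W b m q) (chars b m (s.reg y).toNat) ∧
      Set.EqOn s'.reg s.reg {7, 9, y, a}ᶜ := by
  induction m generalizing q s with
  | zero =>
    refine ⟨s, .loop_false ?_, by simpa using hs, ?_, fun _ _ => rfl⟩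
    · rw [hs.pointer]
      omega
    · simp [simpleTab, xorSum]
  | succ m ih =>
    have hpos : 0 < 2 ^ b := by positivity
    rw [add_one_mul, add_comm (m * 2 ^ b), ← add_assoc] at hend hq
    obtain ⟨s₁, hex₁, hs₁, hy₁, ha₁, hrest₁⟩ := hs.exec_lookupStep hy ha hya hS (by omega)
    have hend₁ : s₁.reg 8 = s.reg 8 := hrest₁ (by simp; omega)
    obtain ⟨s₂, hex₂, hs₂, ha₂, hrest₂⟩ := ih hs₁ (by rw [hend₁]; omega) (by omega)
    refine ⟨s₂, ?_, ?_, ?_, hrest₂.trans hrest₁⟩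
    · refine (Exec.loop_true ?_ hex₁ hex₂).of_steps_eq (by ring)
      rw [hs.pointer]
      omega
    · rwa [add_one_mul, add_comm (m * 2 ^ b), ← add_assoc]
    · rw [ha₂, ha₁, hy₁, simpleTab_tablesAt_succ, BitVec.xor_assoc]

theorem AtTable.exec_lookupBlock {y a k m : ℕ} (hs : AtTable W b m₁ m₂ q s) (hy : 10 ≤ y)
    (ha : 10 ≤ a) (hya : y ≠ a) (hS : S < 2 ^ w) (hk : (s.reg k).toNat = m * 2 ^ b)
    (hq : q + m * 2 ^ b ≤ S) :
    ∃ s' : State w S, Exec (lookupBlock y a k) s (7 * m + 2) s' ∧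
      AtTable W b m₁ m₂ (q + m * 2 ^ b) s' ∧
      s'.reg a = s.reg a ^^^ simpleTab (tablesAt W b m q) (chars b m (s.reg y).toNat) ∧
      Set.EqOn s'.reg s.reg {7, 8, 9, y, a}ᶜ := by
  have hend : ((s.setReg 8 (s.reg 7 + s.reg k)).reg 8).toNat = q + m * 2 ^ b := by
    rw [State.reg_setReg_self, BitVec.toNat_add, hs.pointer, hk, Nat.mod_eq_of_lt (by omega)]
  obtain ⟨s', hex, hs', ha', hrest⟩ :=
    (hs.setReg (by norm_num) _).exec_lookupLoop hy ha hya hS hend hq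
  rw [State.reg_setReg_of_ne _ _ (by omega), State.reg_setReg_of_ne _ _ (by omega)] at ha'
  refine ⟨s', ((Exec.op s .add 8 7 k).seq hex).of_steps_eq (by ring), hs', ha', fun i hi => ?_⟩
  simp only [Set.mem_compl_iff, Set.mem_insert_iff, Set.mem_singleton_iff, not_or] at hi
  rw [hrest (by simp [hi]), State.reg_setReg_of_ne _ _ hi.2.1]

/-- The contribution to the hash value of `x` of the group of tables at the address `q`. -/
def groupValue (W : ℕ → BitVec w) (b m₁ m₂ x q : ℕ) : BitVec w :=
  simpleTab (tablesAt W b m₂ (q + m₁ * 2 ^ b))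
    (chars b m₂ (simpleTab (tablesAt W b m₁ q) (chars b m₁ x)).toNat)

theorem AtTable.exec_groupStep (hs : AtTable W b m₁ m₂ q s) (hS : S < 2 ^ w)
    (hq : q + (m₁ + m₂) * 2 ^ b ≤ S) :
    ∃ s' : State w S, Exec groupStep s (7 * (m₁ + m₂) + 6) s' ∧
      AtTable W b m₁ m₂ (q + (m₁ + m₂) * 2 ^ b) s' ∧
      s'.reg 12 = s.reg 12 ^^^ groupValue W b m₁ m₂ (s.reg 0).toNat q ∧ s'.reg 0 = s.reg 0 := by
  rw [add_mul, ← add_assoc] at hq ⊢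
  set s₁ : State w S := (s.setReg 10 (s.reg 0)).setReg 11 0 with hs₁
  have hinit : AtTable W b m₁ m₂ q s₁ := (hs.setReg (by norm_num) _).setReg (by norm_num) _
  obtain ⟨s₂, hex₂, hs₂, hword, hrest₂⟩ := hinit.exec_lookupBlock (y := 10) (a := 11) (k := 4)
    (by norm_num) (by norm_num) (by norm_num) hS (hinit.param 3) (by omega)
  obtain ⟨s₃, hex₃, hs₃, hvalue, hrest₃⟩ := hs₂.exec_lookupBlock (y := 11) (a := 12) (k := 5)
    (by norm_num) (by norm_num) (by norm_num) hS (hs₂.param 4) hq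
  refine ⟨s₃, ?_, hs₃, ?_, ?_⟩
  · exact ((Exec.move s 10 0).seq ((Exec.const _ 11 0).seq (hex₂.seq hex₃))).of_steps_eq (by ring)
  · have hword' : s₂.reg 11 = simpleTab (tablesAt W b m₁ q) (chars b m₁ (s.reg 0).toNat) := by
      rw [hword]
      simp [hs₁]
    rw [hvalue, hword', hrest₂ (by simp)]
    simp [hs₁, groupValue]
  · rw [hrest₃ (by simp), hrest₂ (by simp)]
    simp [hs₁]

theorem AtTable.exec_groupLoop (hm : 0 < m₁ + m₂) (hS : S < 2 ^ w) {G : ℕ}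
    (hs : AtTable W b m₁ m₂ q s) (hq : q + G * ((m₁ + m₂) * 2 ^ b) = S) :
    ∃ s' : State w S, Exec (.loop 7 6 groupStep) s (G * (7 * (m₁ + m₂) + 7) + 1) s' ∧
      s'.reg 12 = s.reg 12 ^^^ xorSum fun g : Fin G =>
        groupValue W b m₁ m₂ (s.reg 0).toNat (q + g * ((m₁ + m₂) * 2 ^ b)) := by
  induction G generalizing q s with
  | zero =>
    refine ⟨s, .of_steps_eq (.loop_false ?_) (by simp), by simp [xorSum]⟩
    rw [hs.pointer, hs.memEnd]
    omega
  | succ G ih =>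
    have hpos : 0 < (m₁ + m₂) * 2 ^ b := by positivity
    rw [add_one_mul] at hq
    obtain ⟨s₁, hex₁, hs₁, hvalue₁, hkey⟩ := hs.exec_groupStep hS (by omega)
    obtain ⟨s₂, hex₂, hvalue₂⟩ := ih hs₁ (by omega)
    refine ⟨s₂, ?_, ?_⟩
    · refine (Exec.loop_true ?_ hex₁ hex₂).of_steps_eq (by ring)
      rw [hs.pointer, hs.memEnd]
      omega
    · rw [hvalue₂, hvalue₁, hkey, xorSum_succ, BitVec.xor_assoc]
      simp only [Fin.val_zero, zero_mul, add_zero, Fin.val_succ, add_one_mul, add_assoc,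
        add_left_comm q, add_comm ((m₁ + m₂) * 2 ^ b)]

theorem exec_loadParams (hmem : s.mem = fun i : Fin S => W i) (hS : S < 2 ^ w) {k : ℕ}
    (hkS : k ≤ S) (hk : k < 7) :
    ∃ s' : State w S, Exec (loadParams k) s (2 * k + 1) s' ∧ s'.mem = s.mem ∧
      (∀ i < k, s'.reg (i + 1) = W i) ∧ Set.EqOn s'.reg s.reg (insert 7 (Set.Icc 1 k))ᶜ := by
  induction k with
  | zero => exact ⟨s, .skip s, rfl, by simp, fun _ _ => rfl⟩
  | succ k ih =>
    obtain ⟨s₁, hex₁, hmem₁, hloaded, hrest⟩ := ih (by omega) (by omega)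
    set s₂ := s₁.setReg 7 (BitVec.ofNat w k) with hs₂
    have haddr : (s₂.reg 7).toNat = k := by
      rw [hs₂, State.reg_setReg_self, BitVec.toNat_ofNat, Nat.mod_eq_of_lt (by omega)]
    have hlt : (s₂.reg 7).toNat < S := by omega
    have hword : s₂.mem ⟨(s₂.reg 7).toNat, hlt⟩ = W k := by
      have hmem₂ : s₂.mem = fun i : Fin S => W i := hmem₁.trans hmem
      rw [hmem₂]
      exact congrArg W haddr
    refine ⟨_, hex₁.seq ((Exec.const s₁ 7 k).seq (.load s₂ (k + 1) 7 hlt)), hmem₁, ?_, ?_⟩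
    · intro i hi
      rcases Nat.lt_succ_iff_lt_or_eq.1 hi with hik | rfl
      · have hne : i + 1 ≠ k + 1 ∧ i + 1 ≠ 7 := by omega
        rw [State.reg_setReg_of_ne _ _ hne.1, State.reg_setReg_of_ne _ _ hne.2, hloaded i hik]
      · rw [State.reg_setReg_self, hword]
    · intro i hi
      have hi' : i ≠ k + 1 ∧ i ≠ 7 ∧ i ∉ Set.Icc 1 k := by
        simp only [Set.mem_compl_iff, Set.mem_insert_iff, Set.mem_Icc, not_or] at hi ⊢
        omega
      rw [State.reg_setReg_of_ne _ _ hi'.1, hs₂, State.reg_setReg_of_ne _ _ hi'.2.1,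
        hrest (by simp only [Set.mem_compl_iff, Set.mem_insert_iff, hi', or_self, not_false_iff])]

end exec

theorem exec_evalProgram {w S b m₁ m₂ G x : ℕ} {W : ℕ → BitVec w} (hS : S < 2 ^ w)
    (hm : 0 < m₁ + m₂) (hG : 6 + G * ((m₁ + m₂) * 2 ^ b) = S) (hx : x < 2 ^ w)
    (hW : ∀ i : Fin 6, (W i).toNat = layoutParam b m₁ m₂ S i) :
    ∃ s : State w S,
      Exec evalProgram (queryState (fun i : Fin S => W i) x) (G * (7 * (m₁ + m₂) + 7) + 16) s ∧
      s.reg 0 = xorSum fun g : Fin G =>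
        groupValue W b m₁ m₂ x (6 + g * ((m₁ + m₂) * 2 ^ b)) := by
  set s₀ : State w S := queryState (fun i : Fin S => W i) x
  obtain ⟨s₁, hex₁, hmem₁, hloaded, hrest₁⟩ :=
    exec_loadParams (s := s₀) (k := 6) rfl hS (by omega) (by norm_num)
  have hstart : AtTable W b m₁ m₂ 6 (s₁.setReg 7 (BitVec.ofNat w 6)) := by
    refine ⟨hmem₁, fun i => ?_, ?_⟩
    · rw [State.reg_setReg_of_ne _ _ (by omega), hloaded i i.2, hW]
    · rw [State.reg_setReg_self, BitVec.toNat_ofNat, Nat.mod_eq_of_lt (by omega)]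
  obtain ⟨s₂, hex₂, hvalue⟩ := hstart.exec_groupLoop hm hS hG
  have hkey : (s₁.reg 0).toNat = x := by
    rw [hrest₁ (by simp)]
    exact Nat.mod_eq_of_lt hx
  have hzero : s₁.reg 12 = 0 := hrest₁ (by simp)
  refine ⟨s₂.setReg 0 (s₂.reg 12), ?_, ?_⟩
  · exact (hex₁.seq ((Exec.const s₁ 7 6).seq (hex₂.seq (.move s₂ 0 12)))).of_steps_eq (by ring)
  · rw [State.reg_setReg_self, hvalue, State.reg_setReg_of_ne _ _ (by norm_num),
      State.reg_setReg_of_ne _ _ (by norm_num), hkey, hzero]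
    exact BitVec.zero_xor
/-! ### The memory layout -/

/-- The size of the memory: six parameters and, for each of the `d` groups of `c` intermediate
characters, `n` first tables with packed entries and `c` second tables. -/
def memSize (b n c d : ℕ) : ℕ := 6 + d * ((n + c) * 2 ^ b)

theorem layoutParam_le_memSize {b n c d : ℕ} (hnc : 0 < n + c) (hd : 0 < d) (i : Fin 6) :
    layoutParam b n c (memSize b n c d) i ≤ memSize b n c d := by
  have hsize : (n + c) * 2 ^ b ≤ memSize b n c d :=
    (Nat.le_mul_of_pos_left _ hd).trans (Nat.le_add_left _ _)
  have htable : 2 ^ b ≤ (n + c) * 2 ^ b := Nat.le_mul_of_pos_left _ hnc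
  have hlength : b < 2 ^ b := Nat.lt_two_pow_self
  rw [add_mul] at hsize htable
  fin_cases i <;> simp only [layoutParam] <;> simp <;> omega

section layout

variable {b n c d ρ : ℕ} (w : ℕ) (h : FirstTables b n (d * c)) (r : SecondTables b (d * c) ρ)

/-- The entry for the character `a` of the `i`-th table of group `g`. -/
def tableWord (g : Fin d) (i : Fin (n + c)) (a : BitVec b) : BitVec w :=
  Fin.addCases (fun i => pack w fun j : Fin c => h i a (finProdFinEquiv (g, j)))
    (fun j => (r (finProdFinEquiv (g, j)) a).setWidth w) i

/-- The contents of the memory. Addresses beyond its end, which are never read, hold `0`. -/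
def memWord (e : ℕ) : BitVec w :=
  if he : e < 6 then BitVec.ofNat w (layoutParam b n c (memSize b n c d) ⟨e, he⟩)
  else if he : e - 6 < d * ((n + c) * 2 ^ b) then
    let p := finProdFinEquiv.symm ⟨e - 6, he⟩
    let q := finProdFinEquiv.symm p.2
    tableWord w h r p.1 q.1 (BitVec.ofFin q.2)
  else 0

theorem memWord_table (g : Fin d) (i : Fin (n + c)) (a : BitVec b) :
    memWord w h r (6 + g * ((n + c) * 2 ^ b) + i * 2 ^ b + a.toNat) = tableWord w h r g i a := by
  have haddr : 6 + g * ((n + c) * 2 ^ b) + i * 2 ^ b + a.toNat =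
      6 + (finProdFinEquiv (g, finProdFinEquiv (i, a.toFin)) : ℕ) := by
    simp only [finProdFinEquiv_apply_val, BitVec.toNat]
    ring
  rw [haddr, memWord, dif_neg (by omega), dif_pos (by omega)]
  simp only [Nat.add_sub_cancel_left, Fin.eta, Equiv.symm_apply_apply]

theorem tablesAt_memWord_first (g : Fin d) :
    tablesAt (memWord w h r) b n (6 + g * ((n + c) * 2 ^ b)) =
      fun i a => pack w fun j : Fin c => h i a (finProdFinEquiv (g, j)) := by
  funext i a
  rw [tablesAt, ← Fin.val_castAdd c i, memWord_table, tableWord, Fin.addCases_left]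

theorem tablesAt_memWord_second (g : Fin d) :
    tablesAt (memWord w h r) b c (6 + g * ((n + c) * 2 ^ b) + n * 2 ^ b) =
      fun j a => (r (finProdFinEquiv (g, j)) a).setWidth w := by
  funext j a
  rw [tablesAt, add_assoc (6 + _), ← add_mul, ← Fin.val_natAdd n j, memWord_table, tableWord,
    Fin.addCases_right]

theorem groupValue_memWord (hw : b * c ≤ w) (g : Fin d) (x : ℕ) :
    groupValue (memWord w h r) b n c x (6 + g * ((n + c) * 2 ^ b)) =
      xorSum fun j : Fin c => (r (finProdFinEquiv (g, j))
        (simpleTabVec h (chars b n x) (finProdFinEquiv (g, j)))).setWidth w := by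
  rw [groupValue, tablesAt_memWord_first, tablesAt_memWord_second, simpleTab, simpleTab,
    xorSum_pack, chars_pack hw]
  rfl

theorem evaluates_doubleTab {u : ℕ} (hnc : 0 < n + c) (hd : 0 < d) (hw : b * c ≤ w)
    (hu : u ≤ 2 ^ w) (hS : memSize b n c d < 2 ^ w) :
    Evaluates evalProgram w (memSize b n c d) (d * (7 * (n + c) + 7) + 16) (doubleTab u h r) := by
  refine ⟨fun e => memWord w h r e, fun x => ?_⟩
  have hparam (i : Fin 6) : (memWord w h r i).toNat = layoutParam b n c (memSize b n c d) i := by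
    rw [memWord, dif_pos i.2, BitVec.toNat_ofNat,
      Nat.mod_eq_of_lt ((layoutParam_le_memSize hnc hd i).trans_lt hS)]
  obtain ⟨s, hex, hs⟩ := exec_evalProgram hS hnc rfl (x.2.trans_le hu) hparam
  refine ⟨_, s, le_rfl, hex, ?_⟩
  rw [hs]
  simp only [groupValue_memWord w h r hw]
  rw [xorSum_finProd fun j => (r j (simpleTabVec h (chars b n x) j)).setWidth w, ← setWidth_xorSum]
  rfl

end layout
/-! ### The choice of the parameters -/

/-- The length `b` of the characters: `2 * c` of them suffice for a key below `u`. -/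
def charLength (u c : ℕ) : ℕ := Nat.clog (2 ^ (2 * c)) u

/-- The degree of independence. -/
noncomputable def indepDegree (u c : ℕ) : ℕ := ⌈(u : ℝ) ^ ((1 / 32 : ℝ) / (c : ℝ) ^ 2)⌉₊

/-- The number `u ^ (1 / (2 * c))`, which the size of the alphabet exceeds by a factor of at
most `2`. -/
noncomputable def keyRoot (u c : ℕ) : ℝ := (u : ℝ) ^ ((2 * c : ℕ) : ℝ)⁻¹

section parameters

variable {u c : ℕ}

theorem le_two_pow_charLength_pow (u : ℕ) (hc : 1 ≤ c) : u ≤ (2 ^ charLength u c) ^ (2 * c) := by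
  rw [← pow_mul, mul_comm, pow_mul]
  exact Nat.le_pow_clog (Nat.one_lt_two_pow (by omega)) u

theorem two_pow_charLength_pow_le (hc : 1 ≤ c) (hu : 1 < u) :
    (2 ^ charLength u c) ^ (2 * c) ≤ 2 ^ (2 * c) * u := by
  have hbase : 1 < 2 ^ (2 * c) := Nat.one_lt_two_pow (by omega)
  obtain ⟨m, hm⟩ := Nat.exists_eq_succ_of_ne_zero (Nat.clog_pos hbase hu).ne'
  have hlt := Nat.pow_pred_clog_lt_self hbase hu
  rw [charLength, ← pow_mul, mul_comm, pow_mul]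
  rw [hm, Nat.pred_succ] at hlt
  rw [hm, pow_succ']
  gcongr

theorem le_two_pow_charLength_of_pow_le {x : ℕ} (hc : 1 ≤ c) (hx : x ^ (2 * c) ≤ u) :
    x ≤ 2 ^ charLength u c :=
  (Nat.pow_le_pow_iff_left (by omega)).1 (hx.trans (le_two_pow_charLength_pow u hc))

theorem keyRoot_pow (u : ℕ) (hc : 1 ≤ c) : keyRoot u c ^ (2 * c) = u :=
  Real.rpow_inv_natCast_pow (by positivity) (by omega)

theorem keyRoot_nonneg : 0 ≤ keyRoot u c := by
  unfold keyRoot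
  positivity

theorem one_le_keyRoot (hu : 1 ≤ u) : 1 ≤ keyRoot u c :=
  Real.one_le_rpow (by exact_mod_cast hu) (by positivity)

theorem keyRoot_sq : keyRoot u c ^ 2 = (u : ℝ) ^ (1 / (c : ℝ)) := by
  rw [keyRoot, ← Real.rpow_natCast, ← Real.rpow_mul (by positivity)]
  congr 1
  push_cast
  ring

theorem le_keyRoot_of_pow_le {x : ℕ} (hc : 1 ≤ c) (hx : x ^ (2 * c) ≤ u) : x ≤ keyRoot u c := by
  refine (pow_le_pow_iff_left₀ (by positivity) keyRoot_nonneg (by omega : 2 * c ≠ 0)).1 ?_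
  rw [keyRoot_pow u hc]
  exact_mod_cast hx

theorem keyRoot_le_two_pow_charLength (hc : 1 ≤ c) : keyRoot u c ≤ 2 ^ charLength u c := by
  refine (pow_le_pow_iff_left₀ keyRoot_nonneg (by positivity) (by omega : 2 * c ≠ 0)).1 ?_
  rw [keyRoot_pow u hc]
  exact_mod_cast le_two_pow_charLength_pow u hc

theorem two_pow_charLength_le (hc : 1 ≤ c) (hu : 1 < u) :
    (2 : ℝ) ^ charLength u c ≤ 2 * keyRoot u c := by
  refine (pow_le_pow_iff_left₀ (by positivity) (mul_nonneg zero_le_two keyRoot_nonneg)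
    (by omega : 2 * c ≠ 0)).1 ?_
  rw [mul_pow, keyRoot_pow u hc]
  exact_mod_cast two_pow_charLength_pow_le hc hu

theorem one_le_indepDegree (hu : 1 ≤ u) : 1 ≤ indepDegree u c :=
  Nat.one_le_ceil_iff.2 (by positivity)

theorem indepDegree_le (hu : 1 ≤ u) :
    (indepDegree u c : ℝ) ≤ 2 * (u : ℝ) ^ ((1 / 32 : ℝ) / (c : ℝ) ^ 2) := by
  have hroot : 1 ≤ (u : ℝ) ^ ((1 / 32 : ℝ) / (c : ℝ) ^ 2) :=
    Real.one_le_rpow (by exact_mod_cast hu) (by positivity)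
  have hceil : (indepDegree u c : ℝ) < (u : ℝ) ^ ((1 / 32 : ℝ) / (c : ℝ) ^ 2) + 1 :=
    Nat.ceil_lt_add_one (by positivity)
  linarith

theorem one_lt_of_growth (hc : 1 ≤ c) (hgrowth : (4 * c) ^ (66 * c ^ 2) ≤ u) : 1 < u :=
  (Nat.one_lt_pow (by positivity) (by omega)).trans_le hgrowth

theorem pow_le_of_growth {m : ℕ} (hc : 1 ≤ c) (hm : m ≤ 66 * c ^ 2)
    (hgrowth : (4 * c) ^ (66 * c ^ 2) ≤ u) : (4 * c) ^ m ≤ u :=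
  (Nat.pow_le_pow_right (by omega) hm).trans hgrowth

theorem indepDegree_pow_le (hc : 1 ≤ c) (hgrowth : (4 * c) ^ (66 * c ^ 2) ≤ u) :
    (2 * c * indepDegree u c) ^ (4 * (2 * c)) ≤ 2 ^ charLength u c := by
  have hu : 1 < u := one_lt_of_growth hc hgrowth
  set s : ℝ := (u : ℝ) ^ ((1 / 32 : ℝ) / (c : ℝ) ^ 2) with hs
  have hroot : s ^ (32 * c ^ 2) = u := by
    rw [hs, ← Real.rpow_natCast, ← Real.rpow_mul (by positivity)]
    push_cast
    rw [show (1 / 32 / (c : ℝ) ^ 2) * (32 * (c : ℝ) ^ 2) = 1 by field_simp, Real.rpow_one]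
  have hsmall : ((4 * c : ℝ)) ^ (32 * c ^ 2) ≤ u := by
    exact_mod_cast pow_le_of_growth hc (by omega) hgrowth
  have hlarge : (4 * c * s) ^ (16 * c ^ 2) ≤ u := by
    refine (pow_le_pow_iff_left₀ (by positivity) (by positivity) two_ne_zero).1 ?_
    calc ((4 * c * s) ^ (16 * c ^ 2)) ^ 2 = (4 * c : ℝ) ^ (32 * c ^ 2) * s ^ (32 * c ^ 2) := by
          rw [← mul_pow]; ring
      _ ≤ (u : ℝ) ^ 2 := by
          rw [hroot, sq (u : ℝ)]
          gcongr
  refine le_two_pow_charLength_of_pow_le hc ?_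
  have hbase : (2 * c * indepDegree u c : ℝ) ≤ 4 * c * s := by
    calc (2 * c * indepDegree u c : ℝ) ≤ 2 * c * (2 * s) := by
          gcongr
          exact indepDegree_le hu.le
      _ = 4 * c * s := by ring
  have hpow : (2 * c * indepDegree u c : ℝ) ^ (16 * c ^ 2) ≤ u :=
    (pow_le_pow_left₀ (by positivity) hbase _).trans hlarge
  rw [← pow_mul, show 4 * (2 * c) * (2 * c) = 16 * c ^ 2 by ring]
  exact_mod_cast hpow

theorem mul_two_pow_le_two_pow_charLength (hc : 1 ≤ c) (hgrowth : (4 * c) ^ (66 * c ^ 2) ≤ u) :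
    2 * c * 2 ^ (64 * c) ≤ 2 ^ charLength u c := by
  refine le_two_pow_charLength_of_pow_le hc ?_
  calc (2 * c * 2 ^ (64 * c)) ^ (2 * c) = (2 * c * 4 ^ (32 * c)) ^ (2 * c) := by
        rw [show 64 * c = 2 * (32 * c) by ring, pow_mul 2 2]
        norm_num
    _ ≤ (4 * c * (4 * c) ^ (32 * c)) ^ (2 * c) := by gcongr <;> omega
    _ = (4 * c) ^ (64 * c ^ 2 + 2 * c) := by ring
    _ ≤ u := pow_le_of_growth hc (by nlinarith) hgrowth

theorem charLength_mul_le {w : ℕ} (hc : 1 ≤ c) (hgrowth : (4 * c) ^ (66 * c ^ 2) ≤ u)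
    (hw : u ≤ 2 ^ w) : charLength u c * c ≤ w := by
  have hfour : 2 ^ (2 * c) ≤ u := by
    calc 2 ^ (2 * c) = 4 ^ c := by rw [pow_mul]; norm_num
      _ ≤ (4 * c) ^ c := by gcongr; omega
      _ ≤ u := pow_le_of_growth hc (by nlinarith) hgrowth
  have hsq : (2 ^ (charLength u c * c)) ^ 2 ≤ u ^ 2 := by
    calc (2 ^ (charLength u c * c)) ^ 2 = (2 ^ charLength u c) ^ (2 * c) := by ring
      _ ≤ 2 ^ (2 * c) * u := two_pow_charLength_pow_le hc (one_lt_of_growth hc hgrowth)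
      _ ≤ u ^ 2 := by
          rw [sq]
          gcongr
  exact (Nat.pow_le_pow_iff_right one_lt_two).1
    (((Nat.pow_le_pow_iff_left two_ne_zero).1 hsq).trans hw)

theorem memSize_le (hc : 1 ≤ c) (hu : 1 < u) :
    (memSize (charLength u c) (2 * c) c 64 : ℝ) ≤ 400 * (c * keyRoot u c) := by
  have hc1 : (1 : ℝ) ≤ c := by exact_mod_cast hc
  have hroot : 1 ≤ keyRoot u c := one_le_keyRoot hu.le
  calc (memSize (charLength u c) (2 * c) c 64 : ℝ) = 6 + 192 * (c * 2 ^ charLength u c) := by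
        rw [memSize]
        push_cast
        ring
    _ ≤ 6 * (c * keyRoot u c) + 192 * (c * (2 * keyRoot u c)) := by
        gcongr
        · nlinarith
        · exact two_pow_charLength_le hc hu
    _ ≤ 400 * (c * keyRoot u c) := by nlinarith

theorem unifProb_not_isUniversal_le_keyRoot (hc : 1 ≤ c)
    (hgrowth : (4 * c) ^ (66 * c ^ 2) ≤ u) :
    unifProb {h : FirstTables (charLength u c) (2 * c) (64 * c) |
      ¬ IsUniversal u (indepDegree u c) h} ≤ (keyRoot u c ^ 5)⁻¹ := by
  have hu := one_lt_of_growth hc hgrowth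
  have hroot := one_le_keyRoot (c := c) hu.le
  calc _ ≤ (((2 : ℝ) ^ charLength u c) ^ 5)⁻¹ :=
        unifProb_not_isUniversal_le (by omega)
          ((le_two_pow_charLength_pow u hc).trans_eq (pow_mul _ _ _).symm)
          (one_le_indepDegree hu.le) (by omega) (indepDegree_pow_le hc hgrowth)
          (mul_two_pow_le_two_pow_charLength hc hgrowth)
    _ ≤ (keyRoot u c ^ 5)⁻¹ := by
        gcongr
        exact keyRoot_le_two_pow_charLength hc

end parameters

/-! ### Asymptotics -/

section asymptotics

variable {ι : Type*} {l : Filter ι} {u c : ι → ℕ}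

theorem isLittleO_natCast_keyRoot (hu : Tendsto u l atTop) (hc : ∀ i, 1 ≤ c i)
    (hgrowth : ∀ᶠ i in l, (4 * c i) ^ (66 * c i ^ 2) ≤ u i) :
    (fun i => (c i : ℝ)) =o[l] fun i => keyRoot (u i) (c i) := by
  refine isLittleO_iff_nat_mul_le.2 fun K => ?_
  filter_upwards [hgrowth, hu.eventually_ge_atTop ((K * K) ^ (2 * K))] with i hi hK
  rw [Real.norm_of_nonneg (by positivity), Real.norm_of_nonneg keyRoot_nonneg]
  have hpow : (K * c i) ^ (2 * c i) ≤ u i := by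
    rcases le_total K (c i) with h | h
    · calc (K * c i) ^ (2 * c i) ≤ (4 * c i * (4 * c i)) ^ (2 * c i) := by gcongr <;> omega
        _ = (4 * c i) ^ (4 * c i) := by rw [← sq, ← pow_mul]; ring_nf
        _ ≤ u i := pow_le_of_growth (hc i) (by nlinarith [hc i]) hi
    · have hKpos : 0 < K * K := by nlinarith [hc i]
      calc (K * c i) ^ (2 * c i) ≤ (K * K) ^ (2 * c i) := by gcongr
        _ ≤ (K * K) ^ (2 * K) := Nat.pow_le_pow_right hKpos (by omega)
        _ ≤ u i := hK
  exact_mod_cast le_keyRoot_of_pow_le (hc i) hpow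

theorem isLittleO_memSize (hu : Tendsto u l atTop) (hc : ∀ i, 1 ≤ c i)
    (hgrowth : ∀ᶠ i in l, (4 * c i) ^ (66 * c i ^ 2) ≤ u i) :
    (fun i => (memSize (charLength (u i) (c i)) (2 * c i) (c i) 64 : ℝ)) =o[l]
      fun i => (u i : ℝ) ^ (1 / (c i : ℝ)) := by
  simp only [← keyRoot_sq, sq]
  refine IsBigO.trans_isLittleO (IsBigO.of_bound 400 ?_)
    ((isLittleO_natCast_keyRoot hu hc hgrowth).mul_isBigO (isBigO_refl _ l))
  filter_upwards [hu.eventually_gt_atTop 1] with i hi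
  rw [Real.norm_of_nonneg (by positivity),
    Real.norm_of_nonneg (mul_nonneg (by positivity) keyRoot_nonneg)]
  exact memSize_le (hc i) hi

theorem isLittleO_unifProb_not_isUniversal (hu : Tendsto u l atTop) (hc : ∀ i, 1 ≤ c i)
    (hgrowth : ∀ᶠ i in l, (4 * c i) ^ (66 * c i ^ 2) ≤ u i) :
    (fun i => unifProb {h : FirstTables (charLength (u i) (c i)) (2 * c i) (64 * c i) |
        ¬ IsUniversal (u i) (indepDegree (u i) (c i)) h}) =o[l]
      fun i => 1 / (u i : ℝ) ^ (1 / (c i : ℝ)) := by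
  have hone : (fun _ => (1 : ℝ)) =o[l] fun i => keyRoot (u i) (c i) := by
    refine IsBigO.trans_isLittleO (.of_norm_le fun i => ?_)
      (isLittleO_natCast_keyRoot hu hc hgrowth)
    simpa using hc i
  have hcube : (fun i => (keyRoot (u i) (c i) ^ 3)⁻¹) =o[l]
      fun i => 1 / (u i : ℝ) ^ (1 / (c i : ℝ)) := by
    refine (hone.mul_isBigO (isBigO_refl (fun i => (keyRoot (u i) (c i) ^ 3)⁻¹) l)).congr'
      (.of_forall fun i => one_mul _) ?_
    filter_upwards [hu.eventually_ge_atTop 1] with i hi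
    have hpos : 0 < keyRoot (u i) (c i) := one_pos.trans_le (one_le_keyRoot hi)
    rw [← keyRoot_sq]
    field_simp
  refine IsBigO.trans_isLittleO (.of_bound 1 ?_) hcube
  filter_upwards [hgrowth] with i hi
  have hroot := one_le_keyRoot (c := c i) (one_lt_of_growth (hc i) hi).le
  rw [one_mul, Real.norm_of_nonneg (unifProb_nonneg _), Real.norm_of_nonneg (by positivity)]
  refine (unifProb_not_isUniversal_le_keyRoot (hc i) hi).trans ?_
  gcongr
  norm_num

theorem eventually_memSize_lt (hu : Tendsto u l atTop) (hc : ∀ i, 1 ≤ c i)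
    (hgrowth : ∀ᶠ i in l, (4 * c i) ^ (66 * c i ^ 2) ≤ u i) :
    ∀ᶠ i in l, memSize (charLength (u i) (c i)) (2 * c i) (c i) 64 < u i := by
  filter_upwards [(isLittleO_memSize hu hc hgrowth).bound (show (0 : ℝ) < 1 / 2 by norm_num),
    hu.eventually_ge_atTop 1] with i hmem hi
  have hui : (1 : ℝ) ≤ u i := by exact_mod_cast hi
  have hroot : (u i : ℝ) ^ (1 / (c i : ℝ)) ≤ u i :=
    Real.rpow_le_self_of_one_le hui (by rw [one_div]; exact Nat.cast_inv_le_one _)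
  rw [Real.norm_of_nonneg (by positivity), Real.norm_of_nonneg (by positivity)] at hmem
  have hlt : (memSize (charLength (u i) (c i)) (2 * c i) (c i) 64 : ℝ) < u i := by linarith
  exact_mod_cast hlt

theorem eventually_evaluates_doubleTab (hu : Tendsto u l atTop) (hc : ∀ i, 1 ≤ c i)
    (hgrowth : ∀ᶠ i in l, (4 * c i) ^ (66 * c i ^ 2) ≤ u i) :
    ∀ᶠ i in l, ∀ w ρ : ℕ, u i ≤ 2 ^ w →
      ∀ (h : FirstTables (charLength (u i) (c i)) (2 * c i) (64 * c i))
        (r : SecondTables (charLength (u i) (c i)) (64 * c i) ρ),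
        Evaluates evalProgram w (memSize (charLength (u i) (c i)) (2 * c i) (c i) 64)
          (1808 * c i) (doubleTab (u i) h r) := by
  filter_upwards [eventually_memSize_lt hu hc hgrowth, hgrowth] with i hmem hi w ρ hw h r
  have hci := hc i
  exact (evaluates_doubleTab w h r (by omega) (by norm_num) (charLength_mul_le hci hi hw) hw
    (hmem.trans_le hw)).mono (by omega)

end asymptotics

theorem IsPowLittleOOne.eventually_growth {ι : Type} {l : Filter ι} {u c : ι → ℕ}
    (hcu : IsPowLittleOOne l (fun i => (c i : ℝ) ^ (c i ^ 2)) fun i => (u i : ℝ))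
    (hu : Tendsto u l atTop) (hc : ∀ i, 1 ≤ c i) :
    ∀ᶠ i in l, (4 * c i) ^ (66 * c i ^ 2) ≤ u i := by
  obtain ⟨e, he, hpow⟩ := hcu
  filter_upwards [hpow, he.eventually_le_const (show (0 : ℝ) < 1 / 198 by norm_num),
    hu.eventually_ge_atTop (4 ^ 66)] with i hpow he hui
  rcases (hc i).eq_or_lt with h1 | h2
  · simpa [← h1] using hui
  have hu1 : (1 : ℝ) ≤ u i := by exact_mod_cast (Nat.one_le_pow _ _ (by norm_num)).trans hui
  have hcube : (4 * c i : ℝ) ≤ c i ^ 3 := by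
    have hsq : 2 * 2 ≤ c i * c i := Nat.mul_le_mul h2 h2
    have hnat : 4 * c i ≤ c i ^ 3 := by nlinarith [hsq]
    exact_mod_cast hnat
  have hreal : (4 * c i : ℝ) ^ (66 * c i ^ 2) ≤ u i := by
    calc (4 * c i : ℝ) ^ (66 * c i ^ 2) ≤ (c i ^ 3) ^ (66 * c i ^ 2) := by gcongr
      _ = ((c i : ℝ) ^ (c i ^ 2)) ^ 198 := by ring
      _ = (u i : ℝ) ^ (e i * 198) := by
          rw [hpow, Real.rpow_mul (by positivity)]
          norm_cast
      _ ≤ (u i : ℝ) ^ (1 : ℝ) := Real.rpow_le_rpow_of_exponent_le hu1 (by linarith)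
      _ = u i := Real.rpow_one _
  exact_mod_cast hreal

end DoubleTab

theorem corollary3_general :
    ∃ (P : DoubleTab.Cmd) (A : ℕ) (δ : ℝ), 0 < δ ∧
      ∀ (ι : Type*) (l : Filter ι) (u c : ι → ℕ),
        Tendsto u l atTop → (∀ i, 1 ≤ c i) →
        (∀ᶠ i in l, (4 * c i) ^ (66 * c i ^ 2) ≤ u i) →
        ∃ n d b k S : ι → ℕ,
          (∀ᶠ i in l, u i ≤ 2 ^ (b i * n i)) ∧
          (∀ᶠ i in l, (u i : ℝ) ^ (δ / (c i : ℝ) ^ 2) ≤ (k i : ℝ)) ∧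
          (fun i => DoubleTab.unifProb
              {h : DoubleTab.FirstTables (b i) (n i) (d i) |
                ¬ DoubleTab.IsUniversal (u i) (k i) h})
            =o[l] (fun i => 1 / (u i : ℝ) ^ (1 / (c i : ℝ))) ∧
          (fun i => (S i : ℝ)) =o[l] (fun i => (u i : ℝ) ^ (1 / (c i : ℝ))) ∧
          (∀ᶠ i in l, ∀ w ρ : ℕ, u i ≤ 2 ^ w → ρ ≤ w →
            ∀ (h : DoubleTab.FirstTables (b i) (n i) (d i))
              (r : DoubleTab.SecondTables (b i) (d i) ρ),
              DoubleTab.Evaluates P w (S i) (A * c i) (DoubleTab.doubleTab (u i) h r)) := by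
  refine ⟨DoubleTab.evalProgram, 1808, 1 / 32, by norm_num, fun ι l u c hu hc hgrowth => ?_⟩
  refine ⟨fun i => 2 * c i, fun i => 64 * c i, fun i => DoubleTab.charLength (u i) (c i),
    fun i => DoubleTab.indepDegree (u i) (c i),
    fun i => DoubleTab.memSize (DoubleTab.charLength (u i) (c i)) (2 * c i) (c i) 64,
    .of_forall fun i => ?_, .of_forall fun i => Nat.le_ceil _,
    DoubleTab.isLittleO_unifProb_not_isUniversal hu hc hgrowth,
    DoubleTab.isLittleO_memSize hu hc hgrowth, ?_⟩
  · rw [pow_mul]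
    exact DoubleTab.le_two_pow_charLength_pow (u i) (hc i)
  · filter_upwards [DoubleTab.eventually_evaluates_doubleTab hu hc hgrowth] with i h w ρ hw _
    exact h w ρ hw

theorem corollary3 :
    ∃ (P : DoubleTab.Cmd) (A : ℕ) (δ : ℝ), 0 < δ ∧
      ∀ (ι : Type) (l : Filter ι) (u c : ι → ℕ),
        Tendsto u l atTop → (∀ i, 1 ≤ c i) →
        DoubleTab.IsPowLittleOOne l (fun i => (c i : ℝ) ^ (c i ^ 2)) (fun i => (u i : ℝ)) →
        -- `n` input characters and `d` intermediate characters, all of `b` bits;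
        -- independence `k`; `S` words of space
        ∃ n d b k S : ι → ℕ,
          (∀ᶠ i in l, u i ≤ 2 ^ (b i * n i)) ∧
          (∀ᶠ i in l, (u i : ℝ) ^ (δ / (c i : ℝ) ^ 2) ≤ (k i : ℝ)) ∧
          (fun i => DoubleTab.unifProb
              {h : DoubleTab.FirstTables (b i) (n i) (d i) |
                ¬ DoubleTab.IsUniversal (u i) (k i) h})
            =o[l] (fun i => 1 / (u i : ℝ) ^ (1 / (c i : ℝ))) ∧
          (fun i => (S i : ℝ)) =o[l] (fun i => (u i : ℝ) ^ (1 / (c i : ℝ))) ∧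
          (∀ᶠ i in l, ∀ w ρ : ℕ, u i ≤ 2 ^ w → ρ ≤ w →
            ∀ (h : DoubleTab.FirstTables (b i) (n i) (d i))
              (r : DoubleTab.SecondTables (b i) (d i) ρ),
              DoubleTab.Evaluates P w (S i) (A * c i) (DoubleTab.doubleTab (u i) h r)) := by
  obtain ⟨P, A, δ, hδ, hP⟩ := corollary3_general
  exact ⟨P, A, δ, hδ, fun ι l u c hu hc hcu => hP ι l u c hu hc (hcu.eventually_growth hu hc)⟩
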